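/- Let $X=\mathrm{SL}_3(\mathbb{R})/\mathrm{SL}_3(\mathbb{Z})$ be the space of unimodular lattices in $\mathbb{R}^3$, where $g\,\mathrm{SL}_3(\mathbb{Z})$ corresponds to the lattice $g\mathbb{Z}^3$, and let $A\le \mathrm{SL}_3(\mathbb{R})$ be the group of positive diagonal matrices. For an order $\mathcal{O}$ in a totally real cubic field $F$ with real embeddings $\sigma_1,\sigma_2,\sigma_3$ (numbered in some way), put $\varphi=(\sigma_1,\sigma_2,\sigma_3):F\to\mathbb{R}^3$, let $D_{\mathcal{O}}$ be the square of the covolume of $\varphi(\mathcal{O})$, and let $L_{\mathcal{O}}=D_{\mathcal{O}}^{-1/6}\varphi(\mathcal{O})\in X$. For integers $t$ and $n\ge 1$ put $$f_{t,n}(x)=x^3+t\,(2^n x-1)(2^{n-1}x-1).$$ **Theorem.** Let $\varepsilon>0$, let $K\subseteq X$ be compact, and let $N\ge 1$ be an integer. Then there is an integer $T$ such that for every integer $t>T$ there are a totally real cubic field $F$ and a root $\theta\in F$ of $f_{t,N}$ such that, with $\theta_i=2^{i-1}\theta$ for $1\le i\le N$, the rings $\mathbb{Z}[\theta_1],\dots,\mathbb{Z}[\theta_N]$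 are orders in $F$ which form a strictly decreasing chain $$\mathbb{Z}[\theta_1]\supsetneq\mathbb{Z}[\theta_2]\supsetneq\dots\supsetneq\mathbb{Z}[\theta_N],$$ and such that, for every numbering of the real embeddings of $F$ and every $i$, the orbit $A\cdot L_i$ of $L_i=L_{\mathbb{Z}[\theta_i]}$ is compact, it carries a nonzero finite $A$-invariant Borel measure, and every such measure $\mu_i$ satisfies $$\frac{\mu_i(A\cdot L_i\cap K)}{\mu_i(A\cdot L_i)}<\varepsilon .$$ In particular, for each $N$ there is a strictly decreasing chain of $N$ orders $\mathbb{Z}[\theta_1]>\dots>\mathbb{Z}[\theta_N]$ in a totally real cubic field whose compact $A$-orbits each have less than $\varepsilon$ of their mass in $K$. -/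

import Mathlib

open Polynomial MeasureTheory
open scoped Pointwise Matrix

noncomputable section

namespace EscapeOfMass

/-- The image of `SL₃(ℤ)` in `SL₃(ℝ)`. -/
def integerPoints : Subgroup (Matrix.SpecialLinearGroup (Fin 3) ℝ) :=
  (Matrix.SpecialLinearGroup.map (n := Fin 3) (Int.castRingHom ℝ)).range

/-- The space `X = SL₃(ℝ) / SL₃(ℤ)` of unimodular lattices in `ℝ³`, with the quotient topology
and the action of `SL₃(ℝ)` by left translations. -/
abbrev LatticeSpace : Type := Matrix.SpecialLinearGroup (Fin 3) ℝ ⧸ integerPoints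

/-- `X` carries its Borel σ-algebra. -/
instance instMeasurableSpaceLatticeSpace : MeasurableSpace LatticeSpace := borel LatticeSpace

instance instBorelSpaceLatticeSpace : BorelSpace LatticeSpace := ⟨rfl⟩

/-- The lattice `g ℤ³`, spanned by the columns of `g`. -/
def columnLattice (g : Matrix.SpecialLinearGroup (Fin 3) ℝ) : Submodule ℤ (Fin 3 → ℝ) :=
  Submodule.span ℤ (Set.range (g : Matrix (Fin 3) (Fin 3) ℝ).col)

theorem mem_columnLattice (g : Matrix.SpecialLinearGroup (Fin 3) ℝ) (v : Fin 3 → ℝ) :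
    v ∈ columnLattice g ↔
      ∃ z : Fin 3 → ℤ, v = (g : Matrix (Fin 3) (Fin 3) ℝ) *ᵥ (fun i => (z i : ℝ)) := by
  unfold columnLattice
  rw [Submodule.mem_span_range_iff_exists_fun]
  refine exists_congr fun z => ?_
  have h : ∑ i, z i • (g : Matrix (Fin 3) (Fin 3) ℝ).col i
      = (g : Matrix (Fin 3) (Fin 3) ℝ) *ᵥ (fun i => (z i : ℝ)) := by
    ext j
    simp [Matrix.mulVec, dotProduct, Matrix.col, mul_comm]
  rw [h]
  exact eq_comm

theorem columnLattice_mul_le (g : Matrix.SpecialLinearGroup (Fin 3) ℝ)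
    (c : Matrix.SpecialLinearGroup (Fin 3) ℤ) :
    columnLattice (g * Matrix.SpecialLinearGroup.map (Int.castRingHom ℝ) c) ≤ columnLattice g := by
  intro v hv
  obtain ⟨z, rfl⟩ := (mem_columnLattice _ _).1 hv
  refine (mem_columnLattice _ _).2 ⟨(c : Matrix (Fin 3) (Fin 3) ℤ) *ᵥ z, ?_⟩
  refine (congrArg (· *ᵥ (fun i => (z i : ℝ))) (Matrix.SpecialLinearGroup.coe_mul g _)).trans ?_
  refine (Matrix.mulVec_mulVec _ _ _).symm.trans ?_
  congr 1
  ext i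
  simp [Matrix.mulVec, dotProduct]

/-- The unimodular lattice `g ℤ³ ⊆ ℝ³` corresponding to the point `g SL₃(ℤ)` of `X`. -/
def LatticeSpace.toLattice (x : LatticeSpace) : Submodule ℤ (Fin 3 → ℝ) :=
  Quotient.liftOn' x columnLattice (by
    intro g g' h
    rw [QuotientGroup.leftRel_apply] at h
    obtain ⟨c, hc⟩ := h
    have h1 : g' = g * Matrix.SpecialLinearGroup.map (Int.castRingHom ℝ) c := by
      have : Matrix.SpecialLinearGroup.map (Int.castRingHom ℝ) c = g⁻¹ * g' := hc
      rw [this]; group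
    have h2 : g = g' * Matrix.SpecialLinearGroup.map (Int.castRingHom ℝ) c⁻¹ := by
      rw [map_inv, h1]; group
    apply le_antisymm
    · conv_lhs => rw [h2]
      exact columnLattice_mul_le g' c⁻¹
    · conv_lhs => rw [h1]
      exact columnLattice_mul_le g c)

/-- The group `A ≤ SL₃(ℝ)` of positive diagonal matrices. -/
def posDiagonal : Subgroup (Matrix.SpecialLinearGroup (Fin 3) ℝ) where
  carrier := {g | ∃ d : Fin 3 → ℝ, (∀ i, 0 < d i) ∧
    (g : Matrix (Fin 3) (Fin 3) ℝ) = Matrix.diagonal d}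
  one_mem' := ⟨fun _ => 1, fun _ => one_pos, by simp⟩
  mul_mem' := by
    rintro g g' ⟨d, hd, hg⟩ ⟨d', hd', hg'⟩
    refine ⟨fun i => d i * d' i, fun i => mul_pos (hd i) (hd' i), ?_⟩
    exact (Matrix.SpecialLinearGroup.coe_mul g g').trans
      (by rw [hg, hg', Matrix.diagonal_mul_diagonal])
  inv_mem' := by
    rintro g ⟨d, hd, hg⟩
    refine ⟨fun i => (d i)⁻¹, fun i => inv_pos.2 (hd i), ?_⟩
    have h1 : (g : Matrix (Fin 3) (Fin 3) ℝ) * Matrix.diagonal (fun i => (d i)⁻¹) = 1 := by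
      rw [hg, Matrix.diagonal_mul_diagonal, ← Matrix.diagonal_one]
      congr 1
      ext i
      exact mul_inv_cancel₀ (hd i).ne'
    have h2 : ((g⁻¹ : Matrix.SpecialLinearGroup (Fin 3) ℝ) : Matrix (Fin 3) (Fin 3) ℝ) *
        (g : Matrix (Fin 3) (Fin 3) ℝ) = 1 :=
      (Matrix.SpecialLinearGroup.coe_mul g⁻¹ g).symm.trans
        (by rw [inv_mul_cancel]; exact Matrix.SpecialLinearGroup.coe_one)
    exact left_inv_eq_right_inv h2 h1

/-- The orbit `A · x` of a point of `X`. -/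
def diagOrbit (x : LatticeSpace) : Set LatticeSpace := MulAction.orbit posDiagonal x

/-- `μ` is an `A`-invariant measure on the orbit `A · x`: a nonzero finite Borel measure on `X`
that is concentrated on `A · x` and invariant under `A`. -/
structure IsInvariantOrbitMeasure (x : LatticeSpace) (μ : Measure LatticeSpace) : Prop where
  finite : IsFiniteMeasure μ
  ne_zero : μ ≠ 0
  concentrated : μ (diagOrbit x)ᶜ = 0
  invariant : ∀ a ∈ posDiagonal, μ.map (fun y => a • y) = μ

section Orders

variable {F : Type*} [Field F] [NumberField F]

/-- A full module in `F`: the `ℤ`-span of `[F : ℚ]` elements, whose `ℚ`-span is `F`. -/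
def IsFullModule (M : Submodule ℤ F) : Prop :=
  (∃ α : Fin (Module.finrank ℚ F) → F, M = Submodule.span ℤ (Set.range α)) ∧
    Submodule.span ℚ (M : Set F) = ⊤

/-- An order in `F`: a unital subring that is a full module. -/
def IsOrder (O : Subalgebra ℤ F) : Prop := IsFullModule (Subalgebra.toSubmodule O)

/-- The map `α ↦ (σ₁ α, σ₂ α, σ₃ α)` given by an enumeration of the real embeddings of `F`. -/
def realEmbedding (σ : Fin 3 ≃ (F →+* ℝ)) : F →ₗ[ℤ] (Fin 3 → ℝ) :=
  LinearMap.pi fun i => (σ i).toAddMonoidHom.toIntLinearMap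

/-- The discriminant of `M`: the square of the covolume of its image in `ℝ³`. -/
def discriminant (σ : Fin 3 ≃ (F →+* ℝ)) (M : Submodule ℤ F) : ℝ :=
  ZLattice.covolume (M.map (realEmbedding σ)) ^ 2

/-- The lattice `D_M ^ (-1/6) φ(M)` in `ℝ³`, of covolume one. -/
def normalizedLattice (σ : Fin 3 ≃ (F →+* ℝ)) (M : Submodule ℤ F) : Submodule ℤ (Fin 3 → ℝ) :=
  (discriminant σ M ^ (-(1 / 6) : ℝ)) • M.map (realEmbedding σ)

end Orders

/-- The polynomial `f_{t,n}(x) = x³ + t (2ⁿ x - 1) (2ⁿ⁻¹ x - 1)`, for `n ≥ 1`. -/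
def familyPoly (t : ℤ) (n : ℕ) : ℤ[X] :=
  X ^ 3 + C t * (C (2 ^ n) * X - 1) * (C (2 ^ (n - 1)) * X - 1)

end EscapeOfMass

end

noncomputable section

namespace EscapeOfMass

/-! All the orders contain the same units. If `η = 2ᵏθ` with `k < N`, then `η³` equals `-8ᵏt` times
`2ᴺθ - 1` times `2ᴺ⁻¹θ - 1`. Each factor has the form `dη - 1`, so it is coprime to `η` and divides
`η³`; hence it is a unit of `ℤ[η]` (`unit_zpow_mem`).

Put `b = 2ᴺ⁻¹` and `ℓ = log t`. Two roots of the cubic lie near `1/(2b)` and `1/b`, and the third is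
about `-2tb²`. Up to an error `C` depending only on `N`, the logarithm vectors of the two units are
therefore `p = (-ℓ, 0, ℓ)` and `q = (0, -ℓ, ℓ)` (`nearHexagonal`). They span the Lie algebra of `A`,
and the squares of the units stabilize the lattice, so the orbit is a quotient of a torus: it is
compact and carries an invariant measure.

The covolume of the order is at least `t²/2`, so normalization multiplies vectors by about
`t^(-2/3)` or less. At the point `exp(sp + yq)` of the orbit, translate `s` and `y` by integers into
`[-2/3, 1/3]` and take the matching product of units. Its logarithmic coordinates are about `-sℓ`,
`-yℓ`, `(s + y)ℓ`, all at most `2ℓ/3`, and smaller by a multiple of `ℓ` away from the boundary of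
the square. For large `t` the lattice then has a very short vector, hence is outside `K`, unless `s`
or `y` is close to the boundary (`nearInt_of_flow_mem`). Averaging over an `M × M` grid of
translates bounds the mass of that boundary strip by `2/M` (`mul_measure_le_of_nearInt`). -/

/-! ### The space of lattices and Mahler's criterion -/

theorem isClosed_integerPoints :
    IsClosed (integerPoints : Set (Matrix.SpecialLinearGroup (Fin 3) ℝ)) := by
  have h := (Topology.IsClosedEmbedding.specialLinearGroup_map (n := Fin 3)
    (f := Int.castRingHom ℝ) Int.isClosedEmbedding_coe_real).isClosed_range
  simpa [integerPoints] using h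

instance instT2SpaceLatticeSpace : T2Space LatticeSpace := by
  refine (t2Space_iff_of_isOpenQuotientMap
    (QuotientGroup.isOpenQuotientMap_mk (N := integerPoints))).2 ?_
  have h : {q : Matrix.SpecialLinearGroup (Fin 3) ℝ × Matrix.SpecialLinearGroup (Fin 3) ℝ |
      (QuotientGroup.mk q.1 : LatticeSpace) = QuotientGroup.mk q.2} =
      (fun q => q.1⁻¹ * q.2) ⁻¹' (integerPoints : Set (Matrix.SpecialLinearGroup (Fin 3) ℝ)) := by
    ext q
    exact QuotientGroup.eq
  rw [h]
  exact isClosed_integerPoints.preimage (by fun_prop)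

theorem toLattice_mk (g : Matrix.SpecialLinearGroup (Fin 3) ℝ) :
    LatticeSpace.toLattice (QuotientGroup.mk g) = columnLattice g := rfl

/-- One inclusion suffices: both lattices have covolume one, so the integral change of basis has
determinant one. -/
theorem mk_eq_mk_of_columnLattice_le {g g' : Matrix.SpecialLinearGroup (Fin 3) ℝ}
    (h : columnLattice g' ≤ columnLattice g) :
    (QuotientGroup.mk g : LatticeSpace) = QuotientGroup.mk g' := by
  have hcol : ∀ j, (g' : Matrix (Fin 3) (Fin 3) ℝ).col j ∈ columnLattice g := fun j =>
    h (Submodule.subset_span (Set.mem_range_self j))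
  choose z hz using fun j => (mem_columnLattice g _).1 (hcol j)
  let C : Matrix (Fin 3) (Fin 3) ℤ := Matrix.of fun i j => z j i
  have hC : (g' : Matrix (Fin 3) (Fin 3) ℝ) =
      (g : Matrix (Fin 3) (Fin 3) ℝ) * C.map (Int.castRingHom ℝ) := by
    ext i j
    have := congrFun (hz j) i
    simpa [Matrix.col, Matrix.mul_apply, Matrix.mulVec, dotProduct, C] using this
  have hdet : C.det = 1 := by
    have h1 := congrArg Matrix.det hC
    rw [Matrix.det_mul, g.det_coe, g'.det_coe, one_mul] at h1
    have h2 : ((Int.castRingHom ℝ) C.det) = 1 := by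
      rw [RingHom.map_det]; exact h1.symm
    exact Int.cast_injective (h2.trans Int.cast_one.symm)
  refine QuotientGroup.eq.2 ⟨⟨C, hdet⟩, ?_⟩
  rw [eq_inv_mul_iff_mul_eq]
  apply Subtype.ext
  exact (Matrix.SpecialLinearGroup.coe_mul _ _).trans hC.symm

theorem norm_mulVec_le (B : Matrix (Fin 3) (Fin 3) ℝ) (v : Fin 3 → ℝ) :
    ‖B *ᵥ v‖ ≤ (∑ i, ∑ j, |B i j|) * ‖v‖ := by
  refine (pi_norm_le_iff_of_nonneg (by positivity)).2 fun i => ?_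
  have h1 : ‖(B *ᵥ v) i‖ ≤ ∑ j, |B i j| * ‖v‖ := by
    refine (norm_sum_le Finset.univ fun j => B i j * v j).trans (Finset.sum_le_sum fun j _ => ?_)
    rw [norm_mul, Real.norm_eq_abs]
    exact mul_le_mul_of_nonneg_left (norm_le_pi_norm v j) (abs_nonneg _)
  refine h1.trans ?_
  rw [← Finset.sum_mul]
  refine mul_le_mul_of_nonneg_right ?_ (norm_nonneg _)
  exact Finset.single_le_sum (f := fun i => ∑ j, |B i j|) (fun _ _ => by positivity)
    (Finset.mem_univ i)

theorem one_le_norm_intCast {z : Fin 3 → ℤ} (hz : z ≠ 0) : 1 ≤ ‖fun i => (z i : ℝ)‖ := by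
  obtain ⟨i, hi⟩ := Function.ne_iff.1 hz
  refine le_trans ?_ (norm_le_pi_norm _ i)
  rw [Real.norm_eq_abs]
  exact_mod_cast Int.one_le_abs hi

/-- The easy half of Mahler's criterion. -/
theorem exists_pos_le_norm_of_isCompact {K : Set LatticeSpace} (hK : IsCompact K) :
    ∃ r : ℝ, 0 < r ∧ ∀ x ∈ K, ∀ v ∈ x.toLattice, v ≠ 0 → r ≤ ‖v‖ := by
  let size : Matrix.SpecialLinearGroup (Fin 3) ℝ → ℝ := fun g => ∑ i, ∑ j,
    |((g⁻¹ : Matrix.SpecialLinearGroup (Fin 3) ℝ) : Matrix (Fin 3) (Fin 3) ℝ) i j|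
  have hsize : Continuous size := by
    refine continuous_finsetSum _ fun i _ => continuous_finsetSum _ fun j _ => ?_
    have h : Continuous fun g : Matrix.SpecialLinearGroup (Fin 3) ℝ => g⁻¹ := continuous_inv
    exact (Continuous.matrix_elem (Topology.IsInducing.subtypeVal.continuous.comp h) i j).abs
  -- By compactness every point of `K` has a representative `g` with `g⁻¹` bounded. A nonzero
  -- integer vector `z = g⁻¹(gz)` has norm at least one, which bounds `gz` from below.
  let U : ℕ → Set LatticeSpace := fun n => QuotientGroup.mk '' {g | size g < n}
  have hU : ∀ n, IsOpen (U n) := fun n =>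
    QuotientGroup.isOpenQuotientMap_mk.isOpenMap _ (isOpen_lt hsize continuous_const)
  have hmono : Monotone U := fun m n hmn => Set.image_mono fun g (hg : size g < m) =>
    hg.trans_le (by exact_mod_cast hmn)
  obtain ⟨n, hn⟩ := hK.elim_directed_cover U hU (fun x _ => by
    obtain ⟨g, rfl⟩ := QuotientGroup.mk_surjective x
    obtain ⟨n, hn⟩ := exists_nat_gt (size g)
    exact Set.mem_iUnion.2 ⟨n, g, hn, rfl⟩) hmono.directed_le
  refine ⟨1 / (n + 1), by positivity, fun x hx v hv hv0 => ?_⟩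
  obtain ⟨g, hg, rfl⟩ := hn hx
  obtain ⟨z, rfl⟩ := (mem_columnLattice g v).1 hv
  have hz : z ≠ 0 := by
    rintro rfl
    apply hv0
    ext i
    simp [Matrix.mulVec, dotProduct]
  have h1 := norm_mulVec_le ((g⁻¹ : Matrix.SpecialLinearGroup (Fin 3) ℝ) :
    Matrix (Fin 3) (Fin 3) ℝ) ((g : Matrix (Fin 3) (Fin 3) ℝ) *ᵥ fun i => (z i : ℝ))
  rw [Matrix.mulVec_mulVec, ← Matrix.SpecialLinearGroup.coe_mul, inv_mul_cancel,
    Matrix.SpecialLinearGroup.coe_one, Matrix.one_mulVec] at h1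
  have h2 := (one_le_norm_intCast hz).trans h1
  have h3 : size g < n + 1 := by
    have : size g < n := hg
    linarith
  rw [div_le_iff₀ (by positivity)]
  refine h2.trans ?_
  rw [mul_comm]
  exact mul_le_mul_of_nonneg_left h3.le (norm_nonneg _)

/-! ### The diagonal group in exponential coordinates -/

theorem measurable_smul_latticeSpace (g : Matrix.SpecialLinearGroup (Fin 3) ℝ) :
    Measurable fun y : LatticeSpace => g • y :=
  (continuous_const_smul g).measurable

/-- The positive diagonal matrix with entries `exp (w i)`, rescaled to have determinant one. -/
def diagExp (w : Fin 3 → ℝ) : Matrix.SpecialLinearGroup (Fin 3) ℝ :=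
  ⟨Matrix.diagonal fun i => Real.exp (w i - (∑ j, w j) / 3), by
    rw [Matrix.det_diagonal, ← Real.exp_sum]
    simp [Fin.sum_univ_three]
    ring⟩

theorem coe_diagExp (w : Fin 3 → ℝ) : (diagExp w : Matrix (Fin 3) (Fin 3) ℝ) =
    Matrix.diagonal fun i => Real.exp (w i - (∑ j, w j) / 3) := rfl

theorem coe_diagExp_of_sum_eq_zero {w : Fin 3 → ℝ} (hw : ∑ i, w i = 0) :
    (diagExp w : Matrix (Fin 3) (Fin 3) ℝ) = Matrix.diagonal fun i => Real.exp (w i) := by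
  simp [coe_diagExp, hw]

theorem diagExp_add (w w' : Fin 3 → ℝ) : diagExp (w + w') = diagExp w * diagExp w' := by
  apply Subtype.ext
  refine Eq.trans ?_ (Matrix.SpecialLinearGroup.coe_mul _ _).symm
  rw [coe_diagExp, coe_diagExp, coe_diagExp, Matrix.diagonal_mul_diagonal]
  congr 1
  ext i
  rw [← Real.exp_add]
  congr 1
  simp only [Pi.add_apply, Finset.sum_add_distrib]
  ring

theorem diagExp_mem_posDiagonal (w : Fin 3 → ℝ) : diagExp w ∈ posDiagonal :=
  ⟨_, fun _ => Real.exp_pos _, rfl⟩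

theorem exists_diagExp_eq {g : Matrix.SpecialLinearGroup (Fin 3) ℝ} (hg : g ∈ posDiagonal) :
    ∃ w : Fin 3 → ℝ, ∑ i, w i = 0 ∧ diagExp w = g := by
  obtain ⟨d, hd, hgd⟩ := hg
  have hdet : ∏ i, d i = 1 := by
    rw [← Matrix.det_diagonal, ← hgd]; exact g.det_coe
  have hsum : ∑ i, Real.log (d i) = 0 := by
    rw [← Real.log_prod fun i _ => (hd i).ne', hdet, Real.log_one]
  refine ⟨fun i => Real.log (d i), hsum, Subtype.ext ?_⟩
  refine (coe_diagExp_of_sum_eq_zero hsum).trans ?_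
  simp only [Real.exp_log (hd _)]
  exact hgd.symm

theorem continuous_diagExp : Continuous diagExp := by
  refine Topology.IsInducing.subtypeVal.continuous_iff.2 ?_
  exact Continuous.matrix_diagonal (by fun_prop)

theorem mem_diagOrbit_iff {x y : LatticeSpace} :
    y ∈ diagOrbit x ↔ ∃ w : Fin 3 → ℝ, ∑ i, w i = 0 ∧ diagExp w • x = y := by
  constructor
  · rintro ⟨⟨a, ha⟩, rfl⟩
    obtain ⟨w, hw, rfl⟩ := exists_diagExp_eq ha
    exact ⟨w, hw, rfl⟩
  · rintro ⟨w, -, rfl⟩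
    exact ⟨⟨_, diagExp_mem_posDiagonal w⟩, rfl⟩

theorem mem_toLattice_smul {g : Matrix.SpecialLinearGroup (Fin 3) ℝ} {x : LatticeSpace}
    {v : Fin 3 → ℝ} (hv : v ∈ x.toLattice) :
    (g : Matrix (Fin 3) (Fin 3) ℝ) *ᵥ v ∈ (g • x).toLattice := by
  obtain ⟨h, rfl⟩ := QuotientGroup.mk_surjective x
  obtain ⟨z, rfl⟩ := (mem_columnLattice h v).1 hv
  refine (mem_columnLattice (g * h) _).2 ⟨z, ?_⟩
  rw [Matrix.mulVec_mulVec]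
  exact congrArg (· *ᵥ _) (Matrix.SpecialLinearGroup.coe_mul g h).symm

theorem smul_eq_of_mulVec_mem {g : Matrix.SpecialLinearGroup (Fin 3) ℝ} {x : LatticeSpace}
    (h : ∀ v ∈ x.toLattice, (g : Matrix (Fin 3) (Fin 3) ℝ) *ᵥ v ∈ x.toLattice) : g • x = x := by
  obtain ⟨k, rfl⟩ := QuotientGroup.mk_surjective x
  refine (mk_eq_mk_of_columnLattice_le (g := k) (g' := g * k) fun v hv => ?_).symm
  obtain ⟨z, rfl⟩ := (mem_columnLattice _ _).1 hv
  have := h _ ((mem_columnLattice k _).2 ⟨z, rfl⟩)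
  rw [Matrix.mulVec_mulVec] at this
  rw [← Matrix.SpecialLinearGroup.coe_mul] at this
  exact this

/-! ### Compact orbits and their invariant measures -/

section Flow

variable {x : LatticeSpace} {p q : Fin 3 → ℝ}

theorem continuous_diagExp_smul (x : LatticeSpace) (p q : Fin 3 → ℝ) :
    Continuous fun z : ℝ × ℝ => diagExp (z.1 • p + z.2 • q) • x := by
  have h : Continuous fun z : ℝ × ℝ => diagExp (z.1 • p + z.2 • q) :=
    continuous_diagExp.comp (by fun_prop)
  exact h.smul continuous_const

theorem diagExp_smul_mem_diagOrbit (x : LatticeSpace) (w : Fin 3 → ℝ) :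
    diagExp w • x ∈ diagOrbit x :=
  ⟨⟨_, diagExp_mem_posDiagonal w⟩, rfl⟩

theorem diagExp_zsmul_smul {w : Fin 3 → ℝ} (hw : diagExp w • x = x) (m : ℤ) :
    diagExp ((m : ℝ) • w) • x = x := by
  have h0 : diagExp (0 : Fin 3 → ℝ) = 1 := by
    have h := diagExp_add 0 0
    rw [add_zero] at h
    exact (mul_eq_left.1 h.symm)
  have hpos : ∀ n : ℕ, diagExp ((n : ℝ) • w) • x = x := by
    intro n
    induction n with
    | zero => simp [h0]
    | succ n ih =>
      push_cast
      rw [add_smul, one_smul, diagExp_add, mul_smul, hw, ih]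
  obtain ⟨n, rfl | rfl⟩ := m.eq_nat_or_neg
  · exact_mod_cast hpos n
  · have h1 : diagExp (((-(n : ℤ) : ℤ) : ℝ) • w) * diagExp ((n : ℝ) • w) = 1 := by
      rw [← diagExp_add, ← add_smul]
      simp [h0]
    conv_lhs => rw [← hpos n]
    rw [← mul_smul, h1, one_smul]

theorem diagExp_add_intCast_smul (hp : diagExp p • x = x) (hq : diagExp q • x = x) (s y : ℝ)
    (m n : ℤ) :
    diagExp ((s + m) • p + (y + n) • q) • x = diagExp (s • p + y • q) • x := by
  have : (s + m) • p + (y + n) • q = (s • p + y • q) + ((m : ℝ) • p + (n : ℝ) • q) := by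
    simp only [add_smul]; abel
  rw [this, diagExp_add, mul_smul, diagExp_add ((m : ℝ) • p), mul_smul, diagExp_zsmul_smul hq,
    diagExp_zsmul_smul hp]

theorem isCompact_diagOrbit
    (hspan : ∀ w : Fin 3 → ℝ, ∑ i, w i = 0 → ∃ s y : ℝ, w = s • p + y • q)
    (hp : diagExp p • x = x) (hq : diagExp q • x = x) : IsCompact (diagOrbit x) := by
  have h : diagOrbit x = (fun z : ℝ × ℝ => diagExp (z.1 • p + z.2 • q) • x) ''
      (Set.Icc 0 1 ×ˢ Set.Icc 0 1) := by
    ext v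
    constructor
    · intro hv
      obtain ⟨w, hw, rfl⟩ := mem_diagOrbit_iff.1 hv
      obtain ⟨s, y, rfl⟩ := hspan w hw
      refine ⟨(Int.fract s, Int.fract y), ⟨⟨Int.fract_nonneg _, (Int.fract_lt_one _).le⟩,
        ⟨Int.fract_nonneg _, (Int.fract_lt_one _).le⟩⟩, ?_⟩
      have := diagExp_add_intCast_smul hp hq (Int.fract s) (Int.fract y) ⌊s⌋ ⌊y⌋
      rw [Int.fract_add_floor, Int.fract_add_floor] at this
      exact this.symm
    · rintro ⟨z, -, rfl⟩
      exact diagExp_smul_mem_diagOrbit _ _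
  rw [h]
  exact (isCompact_Icc.prod isCompact_Icc).image (continuous_diagExp_smul x p q)

/-- The measure is the image of Haar measure on the torus `(ℝ/ℤ)²` under `(s, y) ↦ exp(sp + yq)x`.
-/
theorem exists_isInvariantOrbitMeasure
    (hspan : ∀ w : Fin 3 → ℝ, ∑ i, w i = 0 → ∃ s y : ℝ, w = s • p + y • q)
    (hp : diagExp p • x = x) (hq : diagExp q • x = x) :
    ∃ μ : Measure LatticeSpace, IsInvariantOrbitMeasure x μ := by
  -- A measurable choice of representatives makes measurability of the orbit map immediate;
  -- equivariance holds because changing a representative by an integer does not move the point.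
  obtain ⟨rep, hrep, hrepm⟩ : ∃ rep : UnitAddCircle → ℝ,
      (∀ τ, ((rep τ : ℝ) : UnitAddCircle) = τ) ∧ Measurable rep :=
    ⟨fun τ => (AddCircle.equivIco 1 0 τ : ℝ), fun τ => AddCircle.coe_equivIco,
      measurable_subtype_coe.comp (AddCircle.measurableEquivIco (1 : ℝ) 0).measurable⟩
  have hrep2 : Measurable fun τ : UnitAddCircle × UnitAddCircle => (rep τ.1, rep τ.2) :=
    (hrepm.comp measurable_fst).prodMk (hrepm.comp measurable_snd)
  obtain ⟨f, hfdef, hf⟩ : ∃ f : ℝ × ℝ → LatticeSpace,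
      (∀ z, f z = diagExp (z.1 • p + z.2 • q) • x) ∧ Measurable f :=
    ⟨_, fun _ => rfl, (continuous_diagExp_smul x p q).measurable⟩
  obtain ⟨Φ, hΦdef, hΦm⟩ : ∃ Φ : UnitAddCircle × UnitAddCircle → LatticeSpace,
      (∀ τ, Φ τ = diagExp (rep τ.1 • p + rep τ.2 • q) • x) ∧ Measurable Φ :=
    ⟨_, fun τ => hfdef (rep τ.1, rep τ.2), Measurable.comp hf hrep2⟩
  have hΦ : ∀ (s y : ℝ) (τ : UnitAddCircle × UnitAddCircle),
      Φ ((s : UnitAddCircle) + τ.1, (y : UnitAddCircle) + τ.2) = diagExp (s • p + y • q) • Φ τ := by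
    intro s y τ
    have key : ∀ (s : ℝ) (τ : UnitAddCircle), ∃ m : ℤ,
        rep ((s : UnitAddCircle) + τ) = (s + rep τ) + m := by
      intro s τ
      have h : ((rep ((s : UnitAddCircle) + τ) : ℝ) : UnitAddCircle) = ((s + rep τ : ℝ)) := by
        rw [hrep, AddCircle.coe_add, hrep]
      obtain ⟨m, hm⟩ := (QuotientAddGroup.eq_iff_sub_mem.1 h)
      refine ⟨m, ?_⟩
      simp only [zsmul_eq_mul, mul_one] at hm
      linarith
    obtain ⟨m, hm⟩ := key s τ.1
    obtain ⟨n, hn⟩ := key y τ.2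
    rw [hΦdef, hΦdef, hm, hn, diagExp_add_intCast_smul hp hq, ← mul_smul, ← diagExp_add]
    congr 2
    simp only [add_smul]
    abel
  let vol : Measure (UnitAddCircle × UnitAddCircle) :=
    (volume : Measure UnitAddCircle).prod (volume : Measure UnitAddCircle)
  have hvol : vol Set.univ = 1 := by
    simp [vol, ← Set.univ_prod_univ, Measure.prod_prod]
  have hfin : vol.map Φ Set.univ = 1 := by
    rw [Measure.map_apply hΦm MeasurableSet.univ, Set.preimage_univ, hvol]
  have hconc : vol.map Φ (diagOrbit x)ᶜ = 0 := by
    rw [Measure.map_apply hΦm (isCompact_diagOrbit hspan hp hq).measurableSet.compl]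
    convert measure_empty (μ := vol)
    exact Set.eq_empty_of_forall_notMem fun τ hτ => hτ (hΦdef τ ▸ diagExp_smul_mem_diagOrbit x _)
  have hinv : ∀ s y : ℝ,
      (vol.map Φ).map (fun v => diagExp (s • p + y • q) • v) = vol.map Φ := by
    intro s y
    have hmp : MeasurePreserving (fun τ : UnitAddCircle × UnitAddCircle =>
        ((s : UnitAddCircle) + τ.1, (y : UnitAddCircle) + τ.2)) vol vol :=
      (measurePreserving_add_left volume (s : UnitAddCircle)).prod
        (measurePreserving_add_left volume (y : UnitAddCircle))
    rw [Measure.map_map (measurable_smul_latticeSpace _) hΦm]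
    conv_rhs => rw [← hmp.map_eq, Measure.map_map hΦm hmp.measurable]
    congr 1
    funext τ
    exact (hΦ s y τ).symm
  generalize vol.map Φ = ν at hfin hconc hinv
  refine ⟨ν, ⟨by rw [hfin]; exact ENNReal.one_lt_top⟩, ?_, hconc, ?_⟩
  · rintro rfl
    simp at hfin
  · intro a ha
    obtain ⟨w, hw, rfl⟩ := exists_diagExp_eq ha
    obtain ⟨s, y, rfl⟩ := hspan w hw
    exact hinv s y

/-! ### Bounding mass by averaging over a grid -/

/-- `s` lies within `1 / (4 M)` of an integer. -/
def NearInt (M : ℕ) (s : ℝ) : Prop := ∃ m : ℤ, |s - m| ≤ 1 / (4 * M)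

open Classical in
-- The points are spaced `1/M` apart on the circle, while the arc around the integers has length
-- only `1/(2M)`.
theorem card_nearInt_le_one (M : ℕ) (s : ℝ) :
    ((Finset.range M).filter fun j : ℕ => NearInt M (s + j / M)).card ≤ 1 := by
  have key : ∀ j k : ℕ, j < k → k < M → NearInt M (s + j / M) → NearInt M (s + k / M) → False := by
    rintro j k hjk hkM ⟨m, hm⟩ ⟨n, hn⟩
    have hM : (0 : ℝ) < M := by exact_mod_cast (Nat.zero_le _).trans_lt hkM
    rw [abs_le] at hm hn
    obtain ⟨hm1, hm2⟩ := hm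
    obtain ⟨hn1, hn2⟩ := hn
    have e : (1 : ℝ) / (4 * M) * M = 1 / 4 := by field_simp
    have ej : (j : ℝ) / M * M = j := by field_simp
    have ek : (k : ℝ) / M * M = k := by field_simp
    have a1 := mul_le_mul_of_nonneg_right hm1 hM.le
    have a2 := mul_le_mul_of_nonneg_right hm2 hM.le
    have b1 := mul_le_mul_of_nonneg_right hn1 hM.le
    have b2 := mul_le_mul_of_nonneg_right hn2 hM.le
    simp only [sub_mul, add_mul, neg_mul, e, ej, ek] at a1 a2 b1 b2
    have c1 : |(((k : ℤ) - j - (n - m) * M : ℤ) : ℝ)| ≤ 1 / 2 := by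
      push_cast
      rw [abs_le]
      constructor <;> linarith
    have c2 : (k : ℤ) - j - (n - m) * M = 0 := by
      by_contra h
      have h1 : (1 : ℝ) ≤ |(((k : ℤ) - j - (n - m) * M : ℤ) : ℝ)| := by
        exact_mod_cast Int.one_le_abs h
      linarith
    have h1 : (0 : ℤ) < (n - m) * M := by lia
    have h2 : (n - m) * M < (1 : ℤ) * M := by lia
    have hMz : (0 : ℤ) < M := by lia
    have h3 := lt_of_mul_lt_mul_right h2 hMz.le
    have h4 := pos_of_mul_pos_left h1 hMz.le
    lia
  refine Finset.card_le_one.2 fun j hj k hk => ?_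
  simp only [Finset.mem_filter, Finset.mem_range] at hj hk
  rcases lt_trichotomy j k with h | h | h
  · exact (key j k h hk.1 hj.2 hk.2).elim
  · exact h
  · exact (key k j h hj.1 hk.2 hj.2).elim

/-- If the flow is in `K` only when one of its two coordinates is near an integer, then `K` has
small mass for every invariant measure. -/
theorem mul_measure_le_of_nearInt
    (hspan : ∀ w : Fin 3 → ℝ, ∑ i, w i = 0 → ∃ s y : ℝ, w = s • p + y • q)
    {K : Set LatticeSpace} (hK : MeasurableSet K) {M : ℕ} (hM : 0 < M) {c : ℝ}
    (h : ∀ s y : ℝ, diagExp (s • p + y • q) • x ∈ K → NearInt M (s + c) ∨ NearInt M (y + c))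
    {μ : Measure LatticeSpace} (hμ : IsInvariantOrbitMeasure x μ) :
    (M : ENNReal) * μ K ≤ 2 * μ Set.univ := by
  classical
  let a : ℕ × ℕ → Matrix.SpecialLinearGroup (Fin 3) ℝ := fun j =>
    diagExp (((j.1 : ℝ) / M) • p + ((j.2 : ℝ) / M) • q)
  let R := Finset.range M ×ˢ Finset.range M
  let E : ℕ × ℕ → Set LatticeSpace := fun j => (fun y => a j • y) ⁻¹' K
  have hE : ∀ j, MeasurableSet (E j) := fun j => measurable_smul_latticeSpace (a j) hK
  have hμE : ∀ j, μ (E j) = μ K := fun j => by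
    rw [← Measure.map_apply (measurable_smul_latticeSpace (a j)) hK,
      hμ.invariant _ (diagExp_mem_posDiagonal _)]
  -- Double counting: the `M²` translates of `K` all have the measure of `K`, while almost every
  -- point lies in at most `2M` of them.
  have hsum : ((M * M : ℕ) : ENNReal) * μ K =
      ∫⁻ y, ∑ j ∈ R, (E j).indicator 1 y ∂μ := by
    rw [lintegral_finsetSum _ fun j _ => (measurable_one.indicator (hE j))]
    simp only [lintegral_indicator_one (hE _), hμE]
    simp [R]
  have hpt : ∀ y ∈ diagOrbit x, ∑ j ∈ R, (E j).indicator (1 : LatticeSpace → ENNReal) y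
      ≤ ((2 * M : ℕ) : ENNReal) := by
    intro y hy
    obtain ⟨w, hw, rfl⟩ := mem_diagOrbit_iff.1 hy
    obtain ⟨s, t, rfl⟩ := hspan w hw
    have h1 : ∑ j ∈ R, (E j).indicator (1 : LatticeSpace → ENNReal)
        (diagExp (s • p + t • q) • x) =
        ((R.filter fun j => diagExp (s • p + t • q) • x ∈ E j).card : ENNReal) := by
      rw [Finset.card_filter]
      push_cast
      refine Finset.sum_congr rfl fun j _ => ?_
      simp [Set.indicator_apply]
    rw [h1]
    refine Nat.cast_le.2 ?_
    -- The grid indices that hit `K` lie in at most one row and one column.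
    let S1 := (Finset.range M).filter fun j : ℕ => NearInt M (s + c + j / M)
    let S2 := (Finset.range M).filter fun j : ℕ => NearInt M (t + c + j / M)
    have hsub : (R.filter fun j => diagExp (s • p + t • q) • x ∈ E j) ⊆
        S1 ×ˢ Finset.range M ∪ Finset.range M ×ˢ S2 := by
      intro j hj
      simp only [Finset.mem_filter, Finset.mem_product, R] at hj
      obtain ⟨⟨hj1, hj2⟩, hj3⟩ := hj
      have hj4 : diagExp ((s + j.1 / M) • p + (t + j.2 / M) • q) • x ∈ K := by
        have : a j • diagExp (s • p + t • q) • x ∈ K := hj3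
        rw [← mul_smul, ← diagExp_add] at this
        convert this using 3
        simp only [add_smul]
        abel
      simp only [Finset.mem_union, Finset.mem_product, Finset.mem_filter, S1, S2]
      rcases h _ _ hj4 with h5 | h5
      · exact Or.inl ⟨⟨hj1, by convert h5 using 1; ring⟩, hj2⟩
      · exact Or.inr ⟨hj1, hj2, by convert h5 using 1; ring⟩
    refine (Finset.card_le_card hsub).trans ((Finset.card_union_le _ _).trans ?_)
    rw [Finset.card_product, Finset.card_product, Finset.card_range]
    have c1 : S1.card ≤ 1 := card_nearInt_le_one M (s + c)
    have c2 : S2.card ≤ 1 := card_nearInt_le_one M (t + c)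
    nlinarith
  have hae : ∀ᵐ y ∂μ, y ∈ diagOrbit x := hμ.concentrated
  have hle : ((M * M : ℕ) : ENNReal) * μ K ≤ ((2 * M : ℕ) : ENNReal) * μ Set.univ := by
    rw [hsum, ← lintegral_const]
    refine lintegral_mono_ae ?_
    filter_upwards [hae] with y hy using hpt y hy
  have hM0 : (M : ENNReal) ≠ 0 := by exact_mod_cast hM.ne'
  have e1 : ((M * M : ℕ) : ENNReal) * μ K = (M : ENNReal) * ((M : ENNReal) * μ K) := by
    push_cast; ring
  have e2 : ((2 * M : ℕ) : ENNReal) * μ Set.univ = (M : ENNReal) * (2 * μ Set.univ) := by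
    push_cast; ring
  rw [e1, e2] at hle
  exact (ENNReal.mul_le_mul_iff_right hM0 (ENNReal.natCast_ne_top M)).1 hle

theorem measure_ratio_lt_of_nearInt
    (hspan : ∀ w : Fin 3 → ℝ, ∑ i, w i = 0 → ∃ s y : ℝ, w = s • p + y • q)
    {K : Set LatticeSpace} (hK : MeasurableSet K) {M : ℕ} (hM : 0 < M) {c ε : ℝ}
    (hMε : 2 / M < ε)
    (h : ∀ s y : ℝ, diagExp (s • p + y • q) • x ∈ K → NearInt M (s + c) ∨ NearInt M (y + c))
    {μ : Measure LatticeSpace} (hμ : IsInvariantOrbitMeasure x μ) :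
    μ (diagOrbit x ∩ K) / μ (diagOrbit x) < ENNReal.ofReal ε := by
  have := hμ.finite
  have huniv : μ (diagOrbit x) = μ Set.univ :=
    measure_eq_measure_of_null_sdiff (Set.subset_univ _) (by
      rw [← Set.compl_eq_univ_sdiff]; exact hμ.concentrated)
  have h0 : μ Set.univ ≠ 0 := by
    rw [Ne, Measure.measure_univ_eq_zero]; exact hμ.ne_zero
  have htop : μ Set.univ ≠ ⊤ := measure_ne_top _ _
  have hM0 : (M : ENNReal) ≠ 0 := by exact_mod_cast hM.ne'
  have h1 := mul_measure_le_of_nearInt hspan hK hM h hμ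
  have h2 : μ (diagOrbit x ∩ K) ≤ ENNReal.ofReal (2 / M) * μ Set.univ := by
    refine (measure_mono Set.inter_subset_right).trans ?_
    rw [ENNReal.ofReal_div_of_pos (by exact_mod_cast hM), ENNReal.ofReal_natCast,
      ENNReal.ofReal_ofNat, ENNReal.div_eq_inv_mul, mul_assoc]
    rw [← ENNReal.div_eq_inv_mul,
      ENNReal.le_div_iff_mul_le (Or.inl hM0) (Or.inl (ENNReal.natCast_ne_top M)), mul_comm]
    exact h1
  rw [huniv]
  refine (ENNReal.div_le_of_le_mul h2).trans_lt ?_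
  have hε : 0 < ε := lt_of_le_of_lt (by positivity) hMε
  exact (ENNReal.ofReal_lt_ofReal_iff hε).2 hMε

end Flow

/-! ### Nearly hexagonal unit lattices and short vectors -/

theorem sum_eq_of_perm (e : Equiv.Perm (Fin 3)) (w : Fin 3 → ℝ) :
    ∑ i, w i = w (e 0) + w (e 1) + w (e 2) := by
  rw [← Equiv.sum_comp e w, Fin.sum_univ_three]

/-- Up to `C` and up to the order of the coordinates, `p = (-ℓ, 0, ℓ)` and `q = (0, -ℓ, ℓ)`. -/
structure NearHexagonal (ℓ C : ℝ) (e : Equiv.Perm (Fin 3)) (p q : Fin 3 → ℝ) : Prop where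
  sum_left : ∑ i, p i = 0
  sum_right : ∑ i, q i = 0
  left_zero : |p (e 0) + ℓ| ≤ C
  left_one : |p (e 1)| ≤ C
  right_zero : |q (e 0)| ≤ C
  right_one : |q (e 1) + ℓ| ≤ C

namespace NearHexagonal

variable {ℓ C : ℝ} {e : Equiv.Perm (Fin 3)} {p q : Fin 3 → ℝ}

theorem exists_eq_smul_add_smul (h : NearHexagonal ℓ C e p q) (hℓ : 2 * C < ℓ) {w : Fin 3 → ℝ}
    (hw : ∑ i, w i = 0) : ∃ s y : ℝ, w = s • p + y • q := by
  obtain ⟨hp, hq, h1, h2, h3, h4⟩ := h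
  rw [abs_le] at h1 h2 h3 h4
  -- The determinant is at least `(ℓ - C)² - C² = ℓ(ℓ - 2C)`; the solution below is Cramer's rule.
  have hdet : 0 < p (e 0) * q (e 1) - p (e 1) * q (e 0) := by
    have a1 : ℓ - C ≤ -p (e 0) := by linarith
    have a2 : ℓ - C ≤ -q (e 1) := by linarith
    have hC : 0 ≤ C := by linarith
    have a3 : (ℓ - C) * (ℓ - C) ≤ -p (e 0) * -q (e 1) :=
      mul_le_mul a1 a2 (by linarith) (by linarith)
    have a4 : p (e 1) * q (e 0) ≤ C * C := by
      refine (le_abs_self _).trans ?_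
      rw [abs_mul]
      exact mul_le_mul (abs_le.2 h2) (abs_le.2 h3) (abs_nonneg _) hC
    nlinarith
  set D := p (e 0) * q (e 1) - p (e 1) * q (e 0) with hD
  set s := (w (e 0) * q (e 1) - w (e 1) * q (e 0)) / D with hs
  set y := (p (e 0) * w (e 1) - p (e 1) * w (e 0)) / D with hy
  have e0 : w (e 0) = s * p (e 0) + y * q (e 0) := by
    rw [hs, hy]
    field_simp
    rw [hD]
    ring
  have e1 : w (e 1) = s * p (e 1) + y * q (e 1) := by
    rw [hs, hy]
    field_simp
    rw [hD]
    ring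
  have e2 : w (e 2) = s * p (e 2) + y * q (e 2) := by
    rw [sum_eq_of_perm e] at hw hp hq
    have f1 : w (e 2) = -w (e 0) - w (e 1) := by linarith
    have f2 : p (e 2) = -p (e 0) - p (e 1) := by linarith
    have f3 : q (e 2) = -q (e 0) - q (e 1) := by linarith
    rw [f1, f2, f3, e0, e1]
    ring
  refine ⟨s, y, funext fun i => ?_⟩
  obtain ⟨j, rfl⟩ := e.surjective i
  simp only [Pi.add_apply, Pi.smul_apply, smul_eq_mul]
  fin_cases j
  exacts [e0, e1, e2]

/-- Up to `4C` the coordinates are `-sℓ`, `-yℓ` and `(s + y)ℓ`. The interval `[-2/3, 1/3]` is the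
one of length one for which `-s`, `-y` and `s + y` have the same maximum, `2/3`. -/
theorem mul_add_mul_le (h : NearHexagonal ℓ C e p q) (hℓ : 0 ≤ ℓ) {δ s y : ℝ} (hδ : 0 ≤ δ)
    (hs1 : δ - 2 / 3 ≤ s) (hs2 : s ≤ 1 / 3 - δ) (hy1 : δ - 2 / 3 ≤ y) (hy2 : y ≤ 1 / 3 - δ)
    (i : Fin 3) : s * p i + y * q i ≤ (2 / 3 - δ) * ℓ + 4 * C := by
  obtain ⟨hp, hq, h1, h2, h3, h4⟩ := h
  have hC : 0 ≤ C := (abs_nonneg _).trans h1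
  have key : ∀ z d : ℝ, |z| ≤ 1 → |d| ≤ C → |z * d| ≤ C := fun z d hz hd => by
    rw [abs_mul]
    calc |z| * |d| ≤ 1 * C := mul_le_mul hz hd (abs_nonneg _) zero_le_one
      _ = C := one_mul C
  have hs : |s| ≤ 1 := abs_le.2 ⟨by linarith, by linarith⟩
  have hy : |y| ≤ 1 := abs_le.2 ⟨by linarith, by linarith⟩
  have a1 := abs_le.1 (key s _ hs h1)
  have a2 := abs_le.1 (key s _ hs h2)
  have a3 := abs_le.1 (key y _ hy h3)
  have a4 := abs_le.1 (key y _ hy h4)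
  rw [sum_eq_of_perm e] at hp hq
  have f2 : p (e 2) = -p (e 0) - p (e 1) := by linarith
  have f3 : q (e 2) = -q (e 0) - q (e 1) := by linarith
  have l1 := mul_le_mul_of_nonneg_right hs1 hℓ
  have l2 := mul_le_mul_of_nonneg_right hs2 hℓ
  have l3 := mul_le_mul_of_nonneg_right hy1 hℓ
  have l4 := mul_le_mul_of_nonneg_right hy2 hℓ
  have l5 := mul_nonneg hδ hℓ
  obtain ⟨j, rfl⟩ := e.surjective i
  fin_cases j
  · change s * p (e 0) + y * q (e 0) ≤ _
    linarith
  · change s * p (e 1) + y * q (e 1) ≤ _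
    linarith
  · change s * p (e 2) + y * q (e 2) ≤ _
    rw [f2, f3]
    linarith

end NearHexagonal

/-- The shift by `2/3` carries the endpoints of `[-2/3, 1/3]` to integers. -/
theorem exists_int_of_not_nearInt {M : ℕ} {s : ℝ} (h : ¬ NearInt M (s + 2 / 3)) :
    ∃ m : ℤ, 1 / (4 * (M : ℝ)) - 2 / 3 ≤ s + m ∧ s + m ≤ 1 / 3 - 1 / (4 * (M : ℝ)) := by
  simp only [NearInt, not_exists, not_le] at h
  have h0 := h ⌊s + 2 / 3⌋
  have h1 := h (⌊s + 2 / 3⌋ + 1)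
  have f0 := Int.floor_le (s + 2 / 3)
  have f1 := Int.lt_floor_add_one (s + 2 / 3)
  push_cast at h1
  rw [abs_of_nonneg (by linarith)] at h0
  rw [abs_of_nonpos (by linarith)] at h1
  refine ⟨-⌊s + 2 / 3⌋, ?_, ?_⟩ <;> push_cast <;> linarith

/-- A lattice with short vectors of all the shapes `exp (m p + n q)` is deep in the cusp along most
of the flow. -/
theorem nearInt_of_flow_mem {ℓ C r c : ℝ} {e : Equiv.Perm (Fin 3)} {p q : Fin 3 → ℝ}
    (h : NearHexagonal ℓ C e p q) {x : LatticeSpace} {K : Set LatticeSpace} (hr : 0 < r)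
    (hK : ∀ x ∈ K, ∀ v ∈ x.toLattice, v ≠ 0 → r ≤ ‖v‖) (hc : 0 < c)
    (hcℓ : Real.log c ≤ -(2 / 3) * ℓ + C)
    (hx : ∀ m n : ℤ, ∃ v ∈ x.toLattice, ∀ i, |v i| = c * Real.exp (m * p i + n * q i))
    {M : ℕ} (hM : 0 < M) (hℓ0 : 0 ≤ ℓ) (hℓ : 4 * M * (5 * C - Real.log r) < ℓ) (s y : ℝ)
    (hsy : diagExp (s • p + y • q) • x ∈ K) : NearInt M (s + 2 / 3) ∨ NearInt M (y + 2 / 3) := by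
  by_contra! hcon
  obtain ⟨m, hm1, hm2⟩ := exists_int_of_not_nearInt hcon.1
  obtain ⟨n, hn1, hn2⟩ := exists_int_of_not_nearInt hcon.2
  obtain ⟨v, hv, hvi⟩ := hx m n
  have hMpos : (0 : ℝ) < M := by exact_mod_cast hM
  have hδ : 0 ≤ 1 / (4 * (M : ℝ)) := by positivity
  have hw0 : ∑ i, (s • p + y • q) i = 0 := by
    simp only [Pi.add_apply, Pi.smul_apply, Finset.sum_add_distrib, ← Finset.smul_sum,
      h.sum_left, h.sum_right, smul_zero, add_zero]
  set w := (diagExp (s • p + y • q) : Matrix (Fin 3) (Fin 3) ℝ) *ᵥ v with hw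
  have hwi : ∀ i, |w i| = c * Real.exp ((s + m) * p i + (y + n) * q i) := by
    intro i
    rw [hw, coe_diagExp_of_sum_eq_zero hw0, Matrix.mulVec_diagonal, abs_mul, hvi i,
      abs_of_pos (Real.exp_pos _), mul_left_comm, ← Real.exp_add]
    congr 2
    simp only [Pi.add_apply, Pi.smul_apply, smul_eq_mul]
    ring
  have hwlt : ∀ i, ‖w i‖ < r := by
    intro i
    rw [Real.norm_eq_abs, hwi, ← Real.log_lt_log_iff (by positivity) hr,
      Real.log_mul hc.ne' (Real.exp_ne_zero _), Real.log_exp]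
    have h1 := h.mul_add_mul_le hℓ0 hδ hm1 hm2 hn1 hn2 i
    -- Of the `5C`, four come from the exponent and one from `log c`; the gain `δℓ` with `δ =
    -- 1/(4M)` must exceed them and `-log r`.
    have h2 : 5 * C - Real.log r < 1 / (4 * (M : ℝ)) * ℓ := by
      rw [one_div, ← div_eq_inv_mul, lt_div_iff₀ (by positivity)]
      linarith
    linarith
  have hwne : w ≠ 0 := by
    intro h0
    have := hwi 0
    rw [h0, Pi.zero_apply, abs_zero] at this
    exact (by positivity : c * Real.exp ((s + m) * p 0 + (y + n) * q 0) ≠ 0) this.symm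
  exact absurd (hK _ hsy w (mem_toLattice_smul hv) hwne)
    (not_le.2 ((pi_norm_lt_iff hr).2 hwlt))

/-! ### Location of the roots and the resulting estimates -/

/-- `r` lists the three real roots of `x³ + t (2 b x - 1) (b x - 1)`, in a fixed order. -/
structure IsRootTriple (b t : ℝ) (r : Fin 3 → ℝ) : Prop where
  lt_zero : 1 / (2 * b) < r 0
  zero_lt : r 0 < 3 / (4 * b)
  lt_one : 3 / (4 * b) < r 1
  one_lt : r 1 < 1 / b
  two_le : r 2 ≤ -(2 * t * b ^ 2)
  eq_prod : ∀ x, x ^ 3 + t * (2 * b * x - 1) * (b * x - 1) = (x - r 0) * (x - r 1) * (x - r 2)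

/-- The cubic equals `x³ > 0` at `1/(2b)` and `1/b`, and is at most `1 - t/8 < 0` at their midpoint.
The third root comes from the sum of the roots, `-2tb²`. -/
theorem exists_isRootTriple {b t : ℝ} (hb : 1 ≤ b) (ht : 16 ≤ t) : ∃ r, IsRootTriple b t r := by
  have hb0 : 0 < b := by linarith
  let f : ℝ → ℝ := fun x => x ^ 3 + t * (2 * b * x - 1) * (b * x - 1)
  have hf : Continuous f := by fun_prop
  have o1 : 1 / (2 * b) < 3 / (4 * b) := by
    rw [div_lt_div_iff₀ (by positivity) (by positivity)]; linarith
  have o2 : 3 / (4 * b) < 1 / b := by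
    rw [div_lt_div_iff₀ (by positivity) (by positivity)]; linarith
  have v1 : 0 < f (1 / (2 * b)) := by
    have : f (1 / (2 * b)) = (1 / (2 * b)) ^ 3 := by
      simp only [f]; field_simp; ring
    rw [this]; positivity
  have v2 : 0 < f (1 / b) := by
    have : f (1 / b) = (1 / b) ^ 3 := by
      simp only [f]; field_simp; ring
    rw [this]; positivity
  have v3 : f (3 / (4 * b)) < 0 := by
    have h1 : f (3 / (4 * b)) = (3 / (4 * b)) ^ 3 - t / 8 := by
      simp only [f]; field_simp; ring
    have h2 : 3 / (4 * b) ≤ 1 := by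
      rw [div_le_one (by positivity)]; linarith
    have h3 : (3 / (4 * b)) ^ 3 ≤ 1 := pow_le_one₀ (by positivity) h2
    rw [h1]; linarith
  obtain ⟨r, ⟨hr1, hr2⟩, hr⟩ := intermediate_value_Ioo' o1.le hf.continuousOn ⟨v3, v1⟩
  obtain ⟨r', ⟨hr1', hr2'⟩, hr'⟩ := intermediate_value_Ioo o2.le hf.continuousOn ⟨v3, v2⟩
  have hpos : 0 < 1 / (2 * b) := by positivity
  have hne : r - r' ≠ 0 := by linarith
  have hq : r ^ 2 + r * r' + r' ^ 2 + 2 * t * b ^ 2 * (r + r') - 3 * t * b = 0 := by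
    refine (mul_eq_zero.1 ?_).resolve_left hne
    have : f r - f r' = 0 := by rw [hr, hr', sub_zero]
    simp only [f] at this
    linear_combination this
  refine ⟨![r, r', -(2 * t * b ^ 2) - r - r'], hr1, hr2, hr1', hr2', ?_, fun x => ?_⟩
  · simp only [Matrix.cons_val]
    linarith
  · simp only [Matrix.cons_val, Matrix.cons_val_zero, Matrix.cons_val_one]
    simp only [f] at hr
    linear_combination hr + (x - r) * hq


namespace IsRootTriple

variable {b t : ℝ} {r : Fin 3 → ℝ}

theorem cube_eq (h : IsRootTriple b t r) (i : Fin 3) :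
    r i ^ 3 = t * ((2 * b * r i - 1) * (1 - b * r i)) := by
  have h1 := h.eq_prod (r i)
  have h2 : (r i - r 0) * (r i - r 1) * (r i - r 2) = 0 := by
    fin_cases i <;> simp
  linear_combination h1 + h2

/-- The product of the `d rᵢ - 1` is `-d³ f(1/d)`, and `f(1/d) = d⁻³` when `1/d` kills the quadratic
part. -/
theorem sum_log_eq_zero (h : IsRootTriple b t r) {d : ℝ} (hd : d ≠ 0)
    (hroot : (2 * b * d⁻¹ - 1) * (b * d⁻¹ - 1) = 0) : ∑ i, Real.log |d * r i - 1| = 0 := by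
  have h1 := h.eq_prod d⁻¹
  rw [mul_assoc, hroot, mul_zero, add_zero] at h1
  have h2 : (d * r 0 - 1) * (d * r 1 - 1) * (d * r 2 - 1) = -1 := by
    have h3 : ∀ i, d * r i - 1 = -(d * (d⁻¹ - r i)) := fun i => by field_simp; ring
    rw [h3, h3, h3]
    calc _ = -(d ^ 3 * ((d⁻¹ - r 0) * (d⁻¹ - r 1) * (d⁻¹ - r 2))) := by ring
      _ = -1 := by rw [← h1]; field_simp
  have h0 : (d * r 0 - 1) ≠ 0 := fun h => by simp [h] at h2
  have h1 : (d * r 1 - 1) ≠ 0 := fun h => by simp [h] at h2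
  have h3 : (d * r 2 - 1) ≠ 0 := fun h => by simp [h] at h2
  rw [Fin.sum_univ_three, ← Real.log_mul (abs_ne_zero.2 h0) (abs_ne_zero.2 h1),
    ← Real.log_mul (mul_ne_zero (abs_ne_zero.2 h0) (abs_ne_zero.2 h1)) (abs_ne_zero.2 h3),
    ← abs_mul, ← abs_mul, h2]
  simp

/-- Here `z` is one of the two small roots and `w` the factor that stays away from zero there. By
`cube_eq`, `3 log z - log w` is `log t` plus the logarithm of the other factor, which is thus about
`-log t`. -/
theorem log_bounds {b z w : ℝ} (hb : 1 ≤ b) (hz1 : 1 / (2 * b) < z) (hz2 : z < 1 / b)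
    (hw1 : 1 / 4 ≤ w) (hw2 : w ≤ 1) : |Real.log w| ≤ Real.log 4 ∧
      |3 * Real.log z - Real.log w| ≤ 3 * Real.log (2 * b) + Real.log 4 := by
  have hb0 : 0 < b := by linarith
  have hz0 : 0 < z := lt_trans (by positivity) hz1
  have hw0 : 0 < w := by linarith
  have a1 : Real.log w ≤ 0 := Real.log_nonpos hw0.le hw2
  have a2 : -Real.log 4 ≤ Real.log w := by
    rw [← Real.log_inv]
    exact Real.log_le_log (by norm_num) (by linarith)
  have a3 : Real.log z ≤ 0 := by
    refine Real.log_nonpos hz0.le (hz2.le.trans ?_)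
    rw [div_le_one hb0]; exact hb
  have a4 : -Real.log (2 * b) ≤ Real.log z := by
    rw [← Real.log_inv, ← one_div]
    exact Real.log_le_log (by positivity) hz1.le
  exact ⟨abs_le.2 ⟨a2, by linarith⟩, abs_le.2 ⟨by linarith, by linarith⟩⟩

theorem nearHexagonal (h : IsRootTriple b t r) (hb : 1 ≤ b) (ht : 16 ≤ t)
    {e : Equiv.Perm (Fin 3)} {ρ : Fin 3 → ℝ} (hρ : ∀ j, ρ (e j) = r j) :
    NearHexagonal (Real.log t) (3 * Real.log (2 * b) + Real.log 4) e
      (fun i => Real.log |2 * b * ρ i - 1|) (fun i => Real.log |b * ρ i - 1|) := by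
  have hb0 : 0 < b := by linarith
  have ht0 : t ≠ 0 := by linarith
  have hlogb : 0 ≤ Real.log (2 * b) := Real.log_nonneg (by linarith)
  have i1 : 1 < 2 * b * r 0 := by
    have := h.lt_zero
    rwa [div_lt_iff₀ (by positivity), mul_comm] at this
  have i2 : b * r 0 < 3 / 4 := by
    have := h.zero_lt
    rw [lt_div_iff₀ (by positivity)] at this
    linarith
  have i3 : 3 / 4 < b * r 1 := by
    have := h.lt_one
    rw [div_lt_iff₀ (by positivity)] at this
    linarith
  have i4 : b * r 1 < 1 := by
    have := h.one_lt
    rwa [lt_div_iff₀ hb0, mul_comm] at this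
  have o1 : 3 / (4 * b) < 1 / b := h.lt_one.trans h.one_lt
  have o2 : 1 / (2 * b) < 3 / (4 * b) := h.lt_zero.trans h.zero_lt
  obtain ⟨a1, a2⟩ := log_bounds hb h.lt_zero (h.zero_lt.trans o1)
    (w := 1 - b * r 0) (by linarith) (by linarith)
  obtain ⟨b1, b2⟩ := log_bounds hb (o2.trans h.lt_one) h.one_lt
    (w := 2 * b * r 1 - 1) (by linarith) (by linarith)
  have c0 := congrArg Real.log (h.cube_eq 0)
  have c1 := congrArg Real.log (h.cube_eq 1)
  have n1 : 2 * b * r 0 - 1 ≠ 0 := by linarith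
  have n2 : 1 - b * r 0 ≠ 0 := by linarith
  have n3 : 2 * b * r 1 - 1 ≠ 0 := by linarith
  have n4 : 1 - b * r 1 ≠ 0 := by linarith
  rw [Real.log_pow, Real.log_mul ht0 (mul_ne_zero n1 n2), Real.log_mul n1 n2] at c0
  rw [Real.log_pow, Real.log_mul ht0 (mul_ne_zero n3 n4), Real.log_mul n3 n4] at c1
  push_cast at c0 c1
  have hsum : ∀ g : ℝ → ℝ, ∑ i, g (ρ i) = ∑ i, g (r i) := fun g => by
    rw [← Equiv.sum_comp e fun i => g (ρ i)]
    simp only [hρ]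
  constructor
  · rw [hsum fun z => Real.log |2 * b * z - 1|]
    exact h.sum_log_eq_zero (by positivity) (by field_simp; ring)
  · rw [hsum fun z => Real.log |b * z - 1|]
    exact h.sum_log_eq_zero (by positivity) (by field_simp; ring)
  · rw [hρ, Real.log_abs]
    convert a2 using 2
    linarith
  · rw [hρ, Real.log_abs]
    linarith
  · rw [hρ, abs_sub_comm, Real.log_abs]
    linarith
  · rw [hρ, abs_sub_comm, Real.log_abs]
    convert b2 using 2
    linarith

theorem le_abs_det_vandermonde (h : IsRootTriple b t r) (hb : 1 ≤ b) (ht : 16 ≤ t)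
    {e : Equiv.Perm (Fin 3)} {ρ : Fin 3 → ℝ} (hρ : ∀ j, ρ (e j) = r j) {s : ℝ} (hs : 1 ≤ s) :
    t ^ 2 / 2 ≤ |(Matrix.vandermonde fun i => s * ρ i).det| := by
  have hb0 : 0 < b := by linarith
  have hperm : |(Matrix.vandermonde fun i => s * ρ i).det| =
      |(Matrix.vandermonde fun i => s * r i).det| := by
    have h1 : (Matrix.vandermonde fun i => s * r i) =
        (Matrix.vandermonde fun i => s * ρ i).submatrix e id := by
      ext i j
      simp [Matrix.vandermonde_apply, hρ]
    rw [h1, Matrix.det_permute, abs_mul]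
    rcases Int.units_eq_one_or (Equiv.Perm.sign e) with h | h <;> simp [h]
  have hdet : (Matrix.vandermonde fun i => s * r i).det =
      s ^ 3 * ((r 1 - r 0) * (r 0 - r 2) * (r 1 - r 2)) := by
    rw [Matrix.det_fin_three]
    simp [Matrix.vandermonde_apply]
    ring
  have i1 : 1 < 2 * b * r 0 := by
    have := h.lt_zero
    rwa [div_lt_iff₀ (by positivity), mul_comm] at this
  have i2 : b * r 0 < 3 / 4 := by
    have := h.zero_lt
    rw [lt_div_iff₀ (by positivity)] at this
    linarith
  have i3 : 3 / 4 < b * r 1 := by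
    have := h.lt_one
    rw [div_lt_iff₀ (by positivity)] at this
    linarith
  have r0pos : 0 < r 0 := lt_trans (by positivity) h.lt_zero
  have r1pos : 0 < r 1 := lt_trans (by positivity) h.lt_one
  have r0le : r 0 ≤ 1 := by nlinarith
  -- This gives `b r₀ ≤ 5/8`, which separates `b r₀` from `b r₁ > 3/4` by `1/8`.
  have hr0 : 2 * b * r 0 - 1 ≤ 1 / 4 := by
    have h1 := h.cube_eq 0
    have h2 : r 0 ^ 3 ≤ 1 := pow_le_one₀ r0pos.le r0le
    have h3 : 16 * ((2 * b * r 0 - 1) * (1 / 4)) ≤ t * ((2 * b * r 0 - 1) * (1 - b * r 0)) :=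
      mul_le_mul ht (mul_le_mul_of_nonneg_left (by linarith) (by linarith))
        (by linarith) (by linarith)
    linarith
  have d1 : 1 / (8 * b) ≤ r 1 - r 0 := by
    rw [div_le_iff₀ (by positivity)]
    linarith
  have d2 : 2 * t * b ^ 2 ≤ r 0 - r 2 := by linarith [h.two_le]
  have d3 : 2 * t * b ^ 2 ≤ r 1 - r 2 := by linarith [h.two_le]
  have ht0 : 0 < t := by linarith
  have hprod : 1 / (8 * b) * (2 * t * b ^ 2) * (2 * t * b ^ 2) ≤
      (r 1 - r 0) * (r 0 - r 2) * (r 1 - r 2) := by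
    have h0 : 0 ≤ 1 / (8 * b) := by positivity
    have h2 : 0 ≤ 2 * t * b ^ 2 := by positivity
    exact mul_le_mul (mul_le_mul d1 d2 h2 (h0.trans d1)) d3 h2
      (mul_nonneg (h0.trans d1) (h2.trans d2))
  have heq : 1 / (8 * b) * (2 * t * b ^ 2) * (2 * t * b ^ 2) = t ^ 2 / 2 * b ^ 3 := by
    field_simp; ring
  have hb3 : 1 ≤ b ^ 3 := one_le_pow₀ hb
  have hs3 : 1 ≤ s ^ 3 := one_le_pow₀ hs
  have ht2 : 0 ≤ t ^ 2 / 2 := by positivity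
  have hP : t ^ 2 / 2 ≤ (r 1 - r 0) * (r 0 - r 2) * (r 1 - r 2) := by nlinarith
  rw [hperm, hdet]
  refine le_trans ?_ (le_abs_self _)
  nlinarith

end IsRootTriple

/-! ### Arithmetic of the family of cubics -/

theorem familyPoly_monic (t : ℤ) (n : ℕ) : (familyPoly t n).Monic := by
  unfold familyPoly
  monicity!

theorem familyPoly_natDegree (t : ℤ) (n : ℕ) : (familyPoly t n).natDegree = 3 := by
  unfold familyPoly
  compute_degree!

theorem aeval_familyPoly {R : Type*} [CommRing R] (t : ℤ) (n : ℕ) (z : R) :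
    aeval z (familyPoly t n) =
      z ^ 3 + (t : R) * (2 ^ n * z - 1) * (2 ^ (n - 1) * z - 1) := by
  simp only [familyPoly, map_add, map_mul, map_sub, map_pow, map_one, aeval_X, aeval_C]
  simp

theorem familyPoly_irreducible {t : ℤ} (ht : t ≠ 0) {n : ℕ} (hn : 1 ≤ n) :
    Irreducible ((familyPoly t n).map (Int.castRingHom ℚ)) := by
  rw [← algebraMap_int_eq,
    ← (familyPoly_monic t n).irreducible_iff_irreducible_map_fraction_map (K := ℚ),
    (familyPoly_monic t n).irreducible_iff_roots_eq_zero_of_degree_le_three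
      (by rw [familyPoly_natDegree]; norm_num) (by rw [familyPoly_natDegree])]
  refine Multiset.eq_zero_of_forall_notMem fun m hm => ?_
  have hroot := (mem_roots'.1 hm).2
  rw [IsRoot.def, ← coe_aeval_eq_eval, aeval_familyPoly] at hroot
  obtain ⟨k, rfl⟩ : ∃ k, n = k + 1 := ⟨n - 1, by lia⟩
  simp only [Nat.add_sub_cancel, Int.cast_id] at hroot
  -- An integer root `m` makes both `2ᵏm` and `2ᵏ⁺¹m` equal to `0` or `2`, so `m = 0`; but the
  -- constant term is `t ≠ 0`.
  have key : ∀ d : ℤ, d * m - 1 ∣ m ^ 3 → d * m - 1 = 1 ∨ d * m - 1 = -1 := by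
    intro d hd
    have hcop : IsCoprime (d * m - 1) m := ⟨-1, d, by ring⟩
    exact Int.isUnit_iff.1 (hcop.pow_right.isUnit_of_dvd' dvd_rfl hd)
  have h1 := key (2 ^ (k + 1)) ⟨-(t * (2 ^ k * m - 1)), by linear_combination hroot⟩
  have h2 := key (2 ^ k) ⟨-(t * (2 ^ (k + 1) * m - 1)), by linear_combination hroot⟩
  have hm0 : 2 ^ k * m = 0 := by
    rw [pow_succ] at h1
    lia
  have hm1 : m = 0 := (mul_eq_zero.1 hm0).resolve_left (by positivity)
  rw [hm1] at hroot
  simp at hroot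
  exact ht hroot

/-- The family is stable under doubling the root, so one argument serves every order of the chain.
Since `k < n`, the exponent `n - k - 1` is not truncated. -/
theorem aeval_two_pow_mul {R : Type*} [CommRing R] {t : ℤ} {n k : ℕ} (hk : k < n) {z : R}
    (hz : aeval z (familyPoly t n) = 0) :
    aeval (2 ^ k * z) (familyPoly (t * 8 ^ k) (n - k)) = 0 := by
  rw [aeval_familyPoly] at hz ⊢
  have e1 : (2 : R) ^ (n - k) * (2 ^ k * z) = 2 ^ n * z := by
    rw [← mul_assoc, ← pow_add, Nat.sub_add_cancel hk.le]
  have e2 : (2 : R) ^ (n - k - 1) * (2 ^ k * z) = 2 ^ (n - 1) * z := by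
    rw [← mul_assoc, ← pow_add]
    congr 3
    lia
  rw [e1, e2]
  push_cast
  have e3 : ((2 : R) ^ k) ^ 3 = 8 ^ k := by
    rw [← pow_mul, mul_comm, pow_mul]; norm_num
  linear_combination (8 : R) ^ k * hz + z ^ 3 * e3

theorem adjoin_eq_span_pow {R : Type*} [CommRing R] {t : ℤ} {n : ℕ} {z : R}
    (hz : aeval z (familyPoly t n) = 0) :
    Subalgebra.toSubmodule (Algebra.adjoin ℤ {z}) =
      Submodule.span ℤ (Set.range fun i : Fin 3 => z ^ (i : ℕ)) := by
  rw [← Submodule.span_range_natDegree_eq_adjoin (familyPoly_monic t n) hz, familyPoly_natDegree]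
  congr 1
  ext w
  simp only [Finset.coe_image, Set.mem_image, Finset.coe_range, Set.mem_Iio, Set.mem_range]
  exact ⟨fun ⟨i, hi, h⟩ => ⟨⟨i, hi⟩, h⟩, fun ⟨i, h⟩ => ⟨i, i.2, h⟩⟩

/-! ### Units and the chain of orders -/

section Field

variable {F : Type*} [Field F] {t : ℤ} {n : ℕ} {η : F}

theorem zpow_mem_of_mul_eq_one {O : Subalgebra ℤ F} {u w : F} (hu : u ∈ O) (hw : w ∈ O)
    (h : u * w = 1) (m : ℤ) : u ^ m ∈ O := by
  obtain ⟨k, rfl | rfl⟩ := m.eq_nat_or_neg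
  · rw [zpow_natCast]; exact pow_mem hu k
  · rw [zpow_neg, zpow_natCast, ← inv_pow, ← eq_inv_of_mul_eq_one_right h]
    exact pow_mem hw k

theorem two_pow_mul_sub_one_mem (k : ℕ) : 2 ^ k * η - 1 ∈ Algebra.adjoin ℤ {η} := by
  refine sub_mem (mul_mem (pow_mem ?_ k) (Algebra.subset_adjoin rfl)) (one_mem _)
  exact_mod_cast (Algebra.adjoin ℤ {η}).natCast_mem 2

/-- A factor `d η - 1` of `η³` is a unit of `ℤ[η]`. -/
theorem zpow_sub_one_mem {d : ℕ} {w : F} (hw : w ∈ Algebra.adjoin ℤ {η})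
    (h : η ^ 3 = (2 ^ d * η - 1) * w) (m : ℤ) :
    (2 ^ d * η - 1) ^ m ∈ Algebra.adjoin ℤ {η} := by
  have h2 : (2 : F) ∈ Algebra.adjoin ℤ {η} := by
    exact_mod_cast (Algebra.adjoin ℤ {η}).natCast_mem 2
  have hη : η ∈ Algebra.adjoin ℤ {η} := Algebra.subset_adjoin rfl
  have hdη : 2 ^ d * η ∈ Algebra.adjoin ℤ {η} := mul_mem (pow_mem h2 d) hη
  -- With `X = 2ᵈη`, the inverse comes from `X³ - 1 = (X - 1)(X² + X + 1)` and `X³ = 2³ᵈ(X - 1)w`.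
  refine zpow_mem_of_mul_eq_one (two_pow_mul_sub_one_mem d)
    (w := (2 ^ d) ^ 3 * w - ((2 ^ d * η) ^ 2 + 2 ^ d * η + 1)) ?_ ?_ m
  · exact sub_mem (mul_mem (pow_mem (pow_mem h2 d) 3) hw)
      (add_mem (add_mem (pow_mem hdη 2) hdη) (one_mem _))
  · linear_combination (-(2 ^ d) ^ 3) * h

theorem unit_zpow_mem (hη : aeval η (familyPoly t n) = 0) (m k : ℤ) :
    (2 ^ n * η - 1) ^ m * (2 ^ (n - 1) * η - 1) ^ k ∈ Algebra.adjoin ℤ {η} := by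
  rw [aeval_familyPoly] at hη
  have ht : (t : F) ∈ Algebra.adjoin ℤ {η} := (Algebra.adjoin ℤ {η}).intCast_mem t
  refine mul_mem (zpow_sub_one_mem (w := -(t * (2 ^ (n - 1) * η - 1)))
    (neg_mem (mul_mem ht (two_pow_mul_sub_one_mem _))) ?_ m)
    (zpow_sub_one_mem (w := -(t * (2 ^ n * η - 1)))
    (neg_mem (mul_mem ht (two_pow_mul_sub_one_mem _))) ?_ k) <;> linear_combination hη

variable [NumberField F] {θ : F}

theorem linearIndependent_smul_pow (hli : LinearIndependent ℚ fun i : Fin 3 => θ ^ (i : ℕ))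
    (k : ℕ) : LinearIndependent ℚ fun i : Fin 3 => (2 ^ k * θ) ^ (i : ℕ) := by
  have h := hli.units_smul fun i => (Units.mk0 (2 ^ k : ℚ) (by positivity)) ^ (i : ℕ)
  convert h using 1
  funext i
  simp [mul_pow, Units.smul_def, Algebra.smul_def]

theorem span_pow_eq_top (hrank : Module.finrank ℚ F = 3)
    (hli : LinearIndependent ℚ fun i : Fin 3 => θ ^ (i : ℕ)) :
    Submodule.span ℚ (Set.range fun i : Fin 3 => θ ^ (i : ℕ)) = ⊤ :=
  hli.span_eq_top_of_card_eq_finrank (by simp [hrank])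

theorem ringHom_ext_of_eq (hrank : Module.finrank ℚ F = 3)
    (hli : LinearIndependent ℚ fun i : Fin 3 => θ ^ (i : ℕ)) {L : Type*} [Field L] [CharZero L]
    {σ τ : F →+* L} (h : σ θ = τ θ) : σ = τ := by
  have h1 : (σ.toRatAlgHom : F →ₐ[ℚ] L).toLinearMap = τ.toRatAlgHom.toLinearMap := by
    refine LinearMap.ext_on_range (span_pow_eq_top hrank hli) fun i => ?_
    simp [h]
  ext x
  exact LinearMap.congr_fun h1 x

theorem isOrder_adjoin (hrank : Module.finrank ℚ F = 3)
    (hli : LinearIndependent ℚ fun i : Fin 3 => η ^ (i : ℕ))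
    (hη : aeval η (familyPoly t n) = 0) : IsOrder (Algebra.adjoin ℤ {η}) := by
  rw [IsOrder, adjoin_eq_span_pow hη]
  refine ⟨⟨fun i => η ^ (i : ℕ), ?_⟩, ?_⟩
  · rw [hrank]
  · rw [eq_top_iff, ← span_pow_eq_top hrank hli]
    exact Submodule.span_mono Submodule.subset_span

theorem strictAnti_adjoin {N : ℕ} (hli : LinearIndependent ℚ fun i : Fin 3 => θ ^ (i : ℕ))
    (hθ : aeval θ (familyPoly t N) = 0) :
    StrictAnti fun k : Fin N => Algebra.adjoin ℤ {2 ^ (k : ℕ) * θ} := by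
  intro k l hkl
  have hkl' : (k : ℕ) < l := hkl
  refine lt_of_le_of_ne ?_ fun heq => ?_
  · refine Algebra.adjoin_le (Set.singleton_subset_iff.2 ?_)
    have h : (2 : F) ^ (l : ℕ) * θ = 2 ^ (l - k : ℕ) * (2 ^ (k : ℕ) * θ) := by
      rw [← mul_assoc, ← pow_add, Nat.sub_add_cancel hkl'.le]
    rw [h]
    refine mul_mem (pow_mem ?_ _) (Algebra.subset_adjoin rfl)
    exact_mod_cast (Algebra.adjoin ℤ {2 ^ (k : ℕ) * θ}).natCast_mem 2
  · have hmem : 2 ^ (k : ℕ) * θ ∈ Subalgebra.toSubmodule (Algebra.adjoin ℤ {2 ^ (l : ℕ) * θ}) := by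
      have h : 2 ^ (k : ℕ) * θ ∈ Algebra.adjoin ℤ {2 ^ (k : ℕ) * θ} := Algebra.subset_adjoin rfl
      simp only at heq
      rw [← heq] at h
      exact h
    rw [adjoin_eq_span_pow (aeval_two_pow_mul l.2 hθ),
      Submodule.mem_span_range_iff_exists_fun] at hmem
    obtain ⟨c, hc⟩ := hmem
    -- Comparing the coefficients of `θ` would force `2ˡ ∣ 2ᵏ` with `k < l`.
    have h0 := Fintype.linearIndependent_iff.1 hli
      ![(c 0 : ℚ), c 1 * 2 ^ (l : ℕ) - 2 ^ (k : ℕ), c 2 * (2 ^ (l : ℕ)) ^ 2] (by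
        simp only [Fin.sum_univ_three, Algebra.smul_def] at hc ⊢
        simp at hc ⊢
        linear_combination hc) 1
    simp only [Matrix.cons_val_one, Matrix.cons_val_zero] at h0
    have h1 : c 1 * 2 ^ (l : ℕ) = 2 ^ (k : ℕ) := by
      have h2 : (c 1 : ℚ) * 2 ^ (l : ℕ) = 2 ^ (k : ℕ) := by linarith
      exact_mod_cast h2
    have h2 : (2 : ℤ) ^ (l : ℕ) ∣ 2 ^ (k : ℕ) := ⟨c 1, by rw [← h1]; ring⟩
    have h3 := Int.le_of_dvd (by positivity) h2
    exact absurd h3 (not_le.2 (pow_lt_pow_right₀ (by norm_num) hkl'))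

end Field

/-! ### Normalized lattices as points of `X` -/

theorem covolume_span_range {w : Fin 3 → Fin 3 → ℝ} (hw : (Matrix.of w).det ≠ 0) :
    ZLattice.covolume (Submodule.span ℤ (Set.range w)) = |(Matrix.of w).det| := by
  have hli : LinearIndependent ℝ w :=
    Matrix.linearIndependent_rows_of_isUnit ((Matrix.isUnit_iff_isUnit_det _).2 hw.isUnit)
  let b : Module.Basis (Fin 3) ℝ (Fin 3 → ℝ) :=
    basisOfLinearIndependentOfCardEqFinrank hli (by simp)
  have hb : ⇑b = w := coe_basisOfLinearIndependentOfCardEqFinrank _ _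
  have hli' : LinearIndependent ℤ w := hli.restrict_scalars' ℤ
  rw [← hb] at hli' hw ⊢
  rw [ZLattice.covolume_eq_det _ (Module.Basis.span hli')]
  congr 3
  funext i
  exact congrArg Subtype.val (Module.Basis.span_apply hli' i)

theorem exists_toLattice_eq {w : Fin 3 → Fin 3 → ℝ} (hw : (Matrix.of w).det ≠ 0) :
    ∃ x : LatticeSpace, x.toLattice = ((ZLattice.covolume (Submodule.span ℤ (Set.range w)) ^ 2) ^
      (-(1 / 6) : ℝ)) • Submodule.span ℤ (Set.range w) := by
  rw [covolume_span_range hw]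
  set D := (Matrix.of w).det with hD
  set c := (|D| ^ 2) ^ (-(1 / 6) : ℝ) with hc
  have hD0 : 0 < |D| := abs_pos.2 hw
  have hc3 : c ^ 3 = |D|⁻¹ := by
    rw [hc, ← Real.rpow_natCast (|D|) 2, ← Real.rpow_mul hD0.le, ← Real.rpow_natCast,
      ← Real.rpow_mul hD0.le, ← Real.rpow_neg_one]
    norm_num
  -- Changing the sign of the first basis vector if necessary makes the determinant `+1` without
  -- changing the lattice.
  obtain ⟨d, hd, hdD⟩ : ∃ d : ℝ, (d = 1 ∨ d = -1) ∧ d * D = |D| := by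
    rcases abs_choice D with h | h
    · exact ⟨1, Or.inl rfl, by rw [h, one_mul]⟩
    · exact ⟨-1, Or.inr rfl, by rw [h, neg_one_mul]⟩
  let s : Fin 3 → ℝ := ![d, 1, 1]
  have hs : ∀ i, s i = 1 ∨ s i = -1 := by
    intro i
    fin_cases i
    · exact hd
    · simp [s]
    · simp [s]
  have hdet : (Matrix.of fun i j => c * (s j * w j i)).det = 1 := by
    have h1 : (Matrix.of fun i j => c * (s j * w j i)).det = c ^ 3 * (d * D) := by
      rw [hD, Matrix.det_fin_three, Matrix.det_fin_three]
      simp [s]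
      ring
    rw [h1, hc3, hdD, inv_mul_cancel₀ hD0.ne']
  let g : Matrix.SpecialLinearGroup (Fin 3) ℝ := ⟨_, hdet⟩
  refine ⟨QuotientGroup.mk g, ?_⟩
  rw [toLattice_mk]
  have hcol : ∀ j, (Matrix.of fun i j => c * (s j * w j i)).col j = c • s j • w j := fun j => rfl
  apply le_antisymm
  · refine Submodule.span_le.2 ?_
    rintro _ ⟨j, rfl⟩
    change (Matrix.of fun i j => c * (s j * w j i)).col j ∈ _
    rw [hcol]
    refine Submodule.smul_mem_pointwise_smul _ _ _ ?_
    have hmem : w j ∈ Submodule.span ℤ (Set.range w) := Submodule.subset_span ⟨j, rfl⟩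
    rcases hs j with h | h
    · rw [h, one_smul]; exact hmem
    · rw [h, neg_one_smul]; exact neg_mem hmem
  · rw [Submodule.smul_span]
    refine Submodule.span_le.2 ?_
    rintro _ ⟨_, ⟨j, rfl⟩, rfl⟩
    have hmem : c • s j • w j ∈ columnLattice g := Submodule.subset_span ⟨j, rfl⟩
    change c • w j ∈ columnLattice g
    rcases hs j with h | h
    · rwa [h, one_smul] at hmem
    · rw [h, neg_one_smul, smul_neg] at hmem
      exact neg_mem_iff.1 hmem

/-! ### Real embeddings and stabilizers -/

section Field

variable {F : Type*} [Field F] {t : ℤ} {n N : ℕ} {η θ : F}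

theorem map_realEmbedding_adjoin (hη : aeval η (familyPoly t n) = 0) (σ : Fin 3 ≃ (F →+* ℝ)) :
    (Subalgebra.toSubmodule (Algebra.adjoin ℤ {η})).map (realEmbedding σ) =
      Submodule.span ℤ (Set.range fun (j i : Fin 3) => σ i η ^ (j : ℕ)) := by
  rw [adjoin_eq_span_pow hη, Submodule.map_span, ← Set.range_comp]
  congr 2
  funext j i
  exact map_pow (σ i) η j

theorem realEmbedding_apply (σ : Fin 3 ≃ (F →+* ℝ)) (α : F) (i : Fin 3) :
    realEmbedding σ α i = σ i α := rfl

/-- If `u` is a unit of `O` then `diag (σ (u²))` fixes the lattice of `O`. -/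
theorem diagExp_two_smul_log_smul {σ : Fin 3 ≃ (F →+* ℝ)} {O : Subalgebra ℤ F} {x : LatticeSpace}
    (hx : x.toLattice = normalizedLattice σ (Subalgebra.toSubmodule O)) {u : F} (hu : u ∈ O)
    (hu0 : u ≠ 0) (hsum : ∑ i, Real.log |σ i u| = 0) :
    diagExp ((2 : ℝ) • fun i => Real.log |σ i u|) • x = x := by
  refine smul_eq_of_mulVec_mem fun v hv => ?_
  rw [hx] at hv ⊢
  obtain ⟨_, ⟨α, hα, rfl⟩, rfl⟩ := hv
  have hsum2 : ∑ i, ((2 : ℝ) • fun i => Real.log |σ i u|) i = 0 := by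
    simp only [Pi.smul_apply, ← Finset.smul_sum, hsum, smul_zero]
  have h : (diagExp ((2 : ℝ) • fun i => Real.log |σ i u|) : Matrix (Fin 3) (Fin 3) ℝ) *ᵥ
      ((discriminant σ (Subalgebra.toSubmodule O) ^ (-(1 / 6) : ℝ)) • realEmbedding σ α) =
      (discriminant σ (Subalgebra.toSubmodule O) ^ (-(1 / 6) : ℝ)) •
        realEmbedding σ (u ^ 2 * α) := by
    rw [coe_diagExp_of_sum_eq_zero hsum2, Matrix.mulVec_smul]
    congr 1
    funext i
    have hpos : 0 < |σ i u| := abs_pos.2 ((map_ne_zero (σ i)).2 hu0)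
    rw [Matrix.mulVec_diagonal, realEmbedding_apply, realEmbedding_apply, map_mul, map_pow,
      Pi.smul_apply, smul_eq_mul, two_mul, Real.exp_add, Real.exp_log hpos, ← sq, sq_abs]
  refine h ▸ Submodule.smul_mem_pointwise_smul _ _ _ ⟨u ^ 2 * α, ?_, rfl⟩
  exact O.mul_mem (O.pow_mem hu 2) hα

variable [NumberField F]

/-- Since `θ` generates `F`, the three embeddings take it to distinct roots. The permutation absorbs
the arbitrary numbering of the embeddings. -/
theorem exists_perm_of_isRootTriple (hrank : Module.finrank ℚ F = 3)
    (hli : LinearIndependent ℚ fun i : Fin 3 => θ ^ (i : ℕ)) {b τ : ℝ} {r : Fin 3 → ℝ}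
    (hr : IsRootTriple b τ r) (σ : Fin 3 ≃ (F →+* ℝ))
    (hσ : ∀ i, σ i θ ^ 3 + τ * (2 * b * σ i θ - 1) * (b * σ i θ - 1) = 0) :
    ∃ e : Equiv.Perm (Fin 3), ∀ j, σ (e j) θ = r j := by
  have h : ∀ i, ∃ j, σ i θ = r j := by
    intro i
    have h1 := hσ i
    rw [hr.eq_prod, mul_eq_zero, mul_eq_zero, sub_eq_zero, sub_eq_zero, sub_eq_zero] at h1
    rcases h1 with (h1 | h1) | h1
    exacts [⟨_, h1⟩, ⟨_, h1⟩, ⟨_, h1⟩]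
  choose g hg using h
  have hinj : Function.Injective g := fun i j hij => σ.injective
    (ringHom_ext_of_eq hrank hli (by rw [hg, hg, hij]))
  let e := Equiv.ofBijective g (Finite.injective_iff_bijective.1 hinj)
  refine ⟨e.symm, fun j => ?_⟩
  rw [hg]
  exact congrArg r (e.apply_symm_apply j)

theorem isTotallyReal_of_isRootTriple (hrank : Module.finrank ℚ F = 3)
    (hli : LinearIndependent ℚ fun i : Fin 3 => θ ^ (i : ℕ)) {b τ : ℝ} {r : Fin 3 → ℝ}
    (hr : IsRootTriple b τ r)
    (hθ : ∀ φ : F →+* ℂ, φ θ ^ 3 + τ * (2 * b * φ θ - 1) * (b * φ θ - 1) = 0) :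
    NumberField.IsTotallyReal F := by
  have hz : ∀ z : ℂ, z ^ 3 + τ * (2 * b * z - 1) * (b * z - 1) =
      (z - r 0) * (z - r 1) * (z - r 2) := by
    -- The values at `0`, `1` and `-1` yield Vieta's relations, which carry the factorization over
    -- to `ℂ`.
    have h0 := hr.eq_prod 0
    have h1 := hr.eq_prod 1
    have h2 := hr.eq_prod (-1)
    have c0 : τ = -(r 0 * r 1 * r 2) := by linear_combination h0
    have c2 : 2 * τ * b ^ 2 = -(r 0 + r 1 + r 2) := by
      linear_combination (h1 + h2) / 2 - h0
    have c1 : -3 * τ * b = r 0 * r 1 + r 0 * r 2 + r 1 * r 2 := by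
      linear_combination (h1 - h2) / 2
    have c0' : (τ : ℂ) = -(r 0 * r 1 * r 2) := by exact_mod_cast c0
    have c2' : 2 * (τ : ℂ) * b ^ 2 = -(r 0 + r 1 + r 2) := by exact_mod_cast c2
    have c1' : -3 * (τ : ℂ) * b = r 0 * r 1 + r 0 * r 2 + r 1 * r 2 := by exact_mod_cast c1
    intro z
    linear_combination c0' + z ^ 2 * c2' + z * c1'
  refine ⟨fun v => ?_⟩
  rw [NumberField.InfinitePlace.isReal_iff, NumberField.ComplexEmbedding.isReal_iff]
  refine ringHom_ext_of_eq hrank hli ?_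
  have h := hθ v.embedding
  rw [hz, mul_eq_zero, mul_eq_zero, sub_eq_zero, sub_eq_zero, sub_eq_zero] at h
  rw [NumberField.ComplexEmbedding.conjugate_coe_eq]
  rcases h with (h | h) | h <;> rw [h, Complex.conj_ofReal]

end Field

/-! ### The orbits of the orders and the choice of `t` -/

section Field

variable {F : Type*} [Field F] {t : ℤ} {N : ℕ} {θ : F}

theorem root_equation (hN : 1 ≤ N) (hθ : aeval θ (familyPoly t N) = 0) {L : Type*} [Field L]
    (φ : F →+* L) :
    φ θ ^ 3 + (t : L) * (2 * 2 ^ (N - 1) * φ θ - 1) * (2 ^ (N - 1) * φ θ - 1) = 0 := by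
  rw [aeval_familyPoly] at hθ
  have h := congrArg φ hθ
  have e : (2 : L) ^ N = 2 * 2 ^ (N - 1) := by
    rw [← pow_succ', Nat.sub_add_cancel hN]
  simp only [map_add, map_mul, map_sub, map_pow, map_one, map_zero, map_intCast, map_ofNat, e] at h
  exact h

variable [NumberField F]

/-- The orbit of the order `ℤ[2ᵏ θ]`: compactness, existence of an invariant measure, and escape
of mass for large `t`. -/
theorem orbit_of_adjoin (hN : 1 ≤ N) (hrank : Module.finrank ℚ F = 3)
    (hli : LinearIndependent ℚ fun i : Fin 3 => θ ^ (i : ℕ))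
    (hθ : aeval θ (familyPoly t N) = 0) (ht : 16 ≤ (t : ℝ)) {C : ℝ}
    (hC : C = 3 * Real.log (2 * 2 ^ (N - 1)) + Real.log 4) (hℓC : 2 * C < Real.log t)
    {K : Set LatticeSpace} (hK : IsCompact K) {ρ : ℝ} (hρ : 0 < ρ)
    (hKρ : ∀ x ∈ K, ∀ v ∈ x.toLattice, v ≠ 0 → ρ ≤ ‖v‖) {M : ℕ} (hM : 0 < M)
    (hℓM : 4 * M * (5 * C - Real.log ρ) < Real.log t) {ε : ℝ} (hMε : 2 / M < ε)
    (σ : Fin 3 ≃ (F →+* ℝ)) (k : Fin N) :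
    ∃ x : LatticeSpace,
      x.toLattice = normalizedLattice σ
        (Subalgebra.toSubmodule (Algebra.adjoin ℤ {2 ^ (k : ℕ) * θ})) ∧
      IsCompact (diagOrbit x) ∧ (∃ μ : Measure LatticeSpace, IsInvariantOrbitMeasure x μ) ∧
      ∀ μ : Measure LatticeSpace, IsInvariantOrbitMeasure x μ →
        μ (diagOrbit x ∩ K) / μ (diagOrbit x) < ENNReal.ofReal ε := by
  have hb : (1 : ℝ) ≤ 2 ^ (N - 1) := one_le_pow₀ (by norm_num)
  have ht0 : (0 : ℝ) < t := by linarith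
  have hlog2 : 0 < Real.log 2 := Real.log_pos (by norm_num)
  have hlog4 : Real.log 4 = 2 * Real.log 2 := by
    rw [show (4 : ℝ) = 2 ^ 2 by norm_num, Real.log_pow]; norm_num
  have hlogb : 0 ≤ Real.log (2 * 2 ^ (N - 1)) := Real.log_nonneg (by linarith)
  obtain ⟨r, hr⟩ := exists_isRootTriple hb ht
  obtain ⟨e, he⟩ := exists_perm_of_isRootTriple hrank hli hr σ
    fun i => root_equation hN hθ (σ i)
  set η := 2 ^ (k : ℕ) * θ with hη
  have hηroot : aeval η (familyPoly (t * 8 ^ (k : ℕ)) (N - k)) = 0 := aeval_two_pow_mul k.2 hθ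
  have hση : ∀ i, σ i η = 2 ^ (k : ℕ) * σ i θ := fun i => by
    rw [hη, map_mul, map_pow, map_ofNat]
  have hhex := hr.nearHexagonal hb ht (ρ := fun i => σ i θ) he
  rw [← hC] at hhex
  set O := Algebra.adjoin ℤ {η} with hO
  have hdet : (t : ℝ) ^ 2 / 2 ≤
      |(Matrix.of fun (j i : Fin 3) => σ i η ^ (j : ℕ)).det| := by
    have h := hr.le_abs_det_vandermonde hb ht (ρ := fun i => σ i θ) he (s := 2 ^ (k : ℕ)) (one_le_pow₀ (by norm_num))
    rw [← Matrix.det_transpose] at h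
    simp only [← hση] at h
    exact h
  have hdet0 : (0 : ℝ) < (t : ℝ) ^ 2 / 2 := by positivity
  have hdetne : (Matrix.of fun (j i : Fin 3) => σ i η ^ (j : ℕ)).det ≠ 0 :=
    abs_pos.1 (hdet0.trans_le hdet)
  obtain ⟨x, hx⟩ := exists_toLattice_eq hdetne
  have hdisc : discriminant σ (Subalgebra.toSubmodule O) =
      |(Matrix.of fun (j i : Fin 3) => σ i η ^ (j : ℕ)).det| ^ 2 := by
    rw [discriminant, hO, map_realEmbedding_adjoin hηroot, covolume_span_range hdetne]
  have hx' : x.toLattice = normalizedLattice σ (Subalgebra.toSubmodule O) := by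
    rw [hx, normalizedLattice, hdisc, hO, map_realEmbedding_adjoin hηroot,
      covolume_span_range hdetne]
  set c := discriminant σ (Subalgebra.toSubmodule O) ^ (-(1 / 6) : ℝ) with hc
  have hdetpos := hdet0.trans_le hdet
  have hcpos : 0 < c := by
    rw [hc, hdisc]
    positivity
  -- Here `c = |det|^(-1/3) ≤ (t²/2)^(-1/3)`, and `(log 2)/3` is absorbed into `C`.
  have hclog : Real.log c ≤ -(2 / 3) * Real.log t + C := by
    rw [hc, hdisc, Real.log_rpow (by positivity), Real.log_pow]
    have h1 := Real.log_le_log hdet0 hdet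
    rw [Real.log_div (by positivity) (by norm_num), Real.log_pow] at h1
    push_cast at h1 ⊢
    linarith
  have hpows : ∀ d : ℕ, (k : ℕ) ≤ d → (2 : F) ^ (d - k) * η = 2 ^ d * θ := fun d hd => by
    rw [hη, ← mul_assoc, ← pow_add, Nat.sub_add_cancel hd]
  have hunit : ∀ m n : ℤ, (2 ^ N * θ - 1) ^ m * (2 ^ (N - 1) * θ - 1) ^ n ∈ O := by
    intro m n
    have h := unit_zpow_mem hηroot m n
    have e2 : N - (k : ℕ) - 1 = N - 1 - k := by lia
    have hk := k.2
    rwa [e2, hpows N (by lia), hpows (N - 1) (by lia)] at h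
  have hσu : ∀ i, σ i (2 ^ N * θ - 1) = 2 * 2 ^ (N - 1) * σ i θ - 1 := fun i => by
    rw [map_sub, map_mul, map_pow, map_ofNat, map_one, ← pow_succ', Nat.sub_add_cancel hN]
  have hσv : ∀ i, σ i (2 ^ (N - 1) * θ - 1) = 2 ^ (N - 1) * σ i θ - 1 := fun i => by
    rw [map_sub, map_mul, map_pow, map_ofNat, map_one]
  simp only [← hσu, ← hσv] at hhex
  have hθ0 : θ ≠ 0 := by
    have := hli.ne_zero 1
    simpa using this
  have hθ3 : (2 ^ N * θ - 1) ≠ 0 ∧ (2 ^ (N - 1) * θ - 1) ≠ 0 := by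
    have h := hθ
    rw [aeval_familyPoly] at h
    constructor <;> intro h0 <;> simp [h0, hθ0] at h
  -- The units may have negative conjugates, so only their squares surely act through `A`. The
  -- periods of the orbit are therefore `2p` and `2q`, whereas the escape estimate below uses `p`
  -- and `q` themselves.
  have hp := diagExp_two_smul_log_smul hx' (by simpa using hunit 1 0) hθ3.1 hhex.sum_left
  have hq := diagExp_two_smul_log_smul hx' (by simpa using hunit 0 1) hθ3.2 hhex.sum_right
  have hspan := fun w hw => hhex.exists_eq_smul_add_smul hℓC (w := w) hw
  have hspan2 : ∀ w : Fin 3 → ℝ, ∑ i, w i = 0 → ∃ s y : ℝ,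
      w = s • ((2 : ℝ) • fun i => Real.log |σ i (2 ^ N * θ - 1)|) +
        y • ((2 : ℝ) • fun i => Real.log |σ i (2 ^ (N - 1) * θ - 1)|) := by
    intro w hw
    obtain ⟨s, y, h⟩ := hspan w hw
    refine ⟨s / 2, y / 2, ?_⟩
    rw [smul_smul, smul_smul, div_mul_cancel₀ _ two_ne_zero, div_mul_cancel₀ _ two_ne_zero]
    exact h
  have hvec : ∀ m n : ℤ, ∃ v ∈ x.toLattice, ∀ i, |v i| = c * Real.exp
      (m * Real.log |σ i (2 ^ N * θ - 1)| + n * Real.log |σ i (2 ^ (N - 1) * θ - 1)|) := by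
    intro m n
    refine ⟨c • realEmbedding σ ((2 ^ N * θ - 1) ^ m * (2 ^ (N - 1) * θ - 1) ^ n), ?_, fun i => ?_⟩
    · rw [hx']
      exact Submodule.smul_mem_pointwise_smul _ _ _ ⟨_, hunit m n, rfl⟩
    · have hexp : ∀ (z : ℝ) (m : ℤ), z ≠ 0 → Real.exp (m * Real.log |z|) = |z| ^ m :=
        fun z m hz => by
          rw [mul_comm, ← Real.rpow_def_of_pos (abs_pos.2 hz), Real.rpow_intCast]
      rw [Pi.smul_apply, smul_eq_mul, abs_mul, abs_of_pos hcpos, realEmbedding_apply, map_mul,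
        map_zpow₀, map_zpow₀, abs_mul, abs_zpow, abs_zpow, Real.exp_add,
        hexp _ _ ((_root_.map_ne_zero _).2 hθ3.1), hexp _ _ ((_root_.map_ne_zero _).2 hθ3.2)]
  refine ⟨x, hx', isCompact_diagOrbit hspan2 hp hq, exists_isInvariantOrbitMeasure hspan2 hp hq,
    fun μ hμ => ?_⟩
  have hC0 : 0 ≤ C := by rw [hC]; linarith
  exact measure_ratio_lt_of_nearInt hspan hK.measurableSet hM hMε
    (fun s y hsy => nearInt_of_flow_mem hhex hρ hKρ hcpos hclog hvec hM (by linarith) hℓM s y hsy)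
    hμ

end Field

theorem exists_cubicField {f : ℚ[X]} (hirr : Irreducible f) (hfm : f.Monic)
    (hfd : f.natDegree = 3) :
    ∃ (F : Type) (_ : Field F) (_ : NumberField F) (θ : F), Module.finrank ℚ F = 3 ∧
      (LinearIndependent ℚ fun i : Fin 3 => θ ^ (i : ℕ)) ∧ aeval θ f = 0 := by
  have : Fact (Irreducible f) := ⟨hirr⟩
  let B := AdjoinRoot.powerBasis hfm.ne_zero
  -- The power basis uses one `ℚ`-algebra structure and `NumberField` the other.
  have hA : (AdjoinRoot.instAlgebra f : Algebra ℚ (AdjoinRoot f)) = DivisionRing.toRatAlgebra :=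
    Subsingleton.elim _ _
  have hfin : FiniteDimensional ℚ (AdjoinRoot f) := by
    rw [← hA]
    exact B.finite
  have : NumberField (AdjoinRoot f) := ⟨⟩
  have hrank : Module.finrank ℚ (AdjoinRoot f) = 3 := by
    rw [← hA, B.finrank, AdjoinRoot.powerBasis_dim, hfd]
  have hroot : aeval (AdjoinRoot.root f) f = 0 := by
    rw [aeval_def, Subsingleton.elim (algebraMap ℚ (AdjoinRoot f)) (AdjoinRoot.of f),
      AdjoinRoot.eval₂_root]
  refine ⟨AdjoinRoot f, inferInstance, this, AdjoinRoot.root f, hrank, ?_, hroot⟩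
  have hmin : (minpoly ℚ (AdjoinRoot.root f)).natDegree = 3 := by
    rw [← minpoly.eq_of_irreducible_of_monic hirr hroot hfm, hfd]
  have h := linearIndependent_pow (K := ℚ) (AdjoinRoot.root f)
  rwa [hmin] at h

end EscapeOfMass
end

theorem mainTheorem10 (ε : ℝ) (hε : 0 < ε) (K : Set EscapeOfMass.LatticeSpace)
    (hK : IsCompact K) (N : ℕ) (hN : 1 ≤ N) :
    ∃ T : ℤ, ∀ t : ℤ, T < t →
      ∃ (F : Type) (_ : Field F) (_ : NumberField F) (θ : F),
        Module.finrank ℚ F = 3 ∧ NumberField.IsTotallyReal F ∧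
        Polynomial.aeval θ (EscapeOfMass.familyPoly t N) = 0 ∧
        (∀ k : Fin N, EscapeOfMass.IsOrder (Algebra.adjoin ℤ {2 ^ (k : ℕ) * θ})) ∧
        StrictAnti (fun k : Fin N => Algebra.adjoin ℤ {2 ^ (k : ℕ) * θ}) ∧
        ∀ (σ : Fin 3 ≃ (F →+* ℝ)) (k : Fin N),
          ∃ x : EscapeOfMass.LatticeSpace,
            x.toLattice = EscapeOfMass.normalizedLattice σ
              (Subalgebra.toSubmodule (Algebra.adjoin ℤ {2 ^ (k : ℕ) * θ})) ∧
            IsCompact (EscapeOfMass.diagOrbit x) ∧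
            (∃ μ : MeasureTheory.Measure EscapeOfMass.LatticeSpace,
              EscapeOfMass.IsInvariantOrbitMeasure x μ) ∧
            ∀ μ : MeasureTheory.Measure EscapeOfMass.LatticeSpace,
              EscapeOfMass.IsInvariantOrbitMeasure x μ →
                μ (EscapeOfMass.diagOrbit x ∩ K) / μ (EscapeOfMass.diagOrbit x) <
                  ENNReal.ofReal ε := by
  obtain ⟨ρ, hρ, hKρ⟩ := EscapeOfMass.exists_pos_le_norm_of_isCompact hK
  obtain ⟨M, hMε⟩ := exists_nat_gt (2 / ε)
  have hM : 0 < M := by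
    have : (0 : ℝ) < M := lt_trans (by positivity) hMε
    exact_mod_cast this
  have hMε' : 2 / (M : ℝ) < ε := by
    rw [div_lt_iff₀ hε] at hMε
    rw [div_lt_iff₀ (by exact_mod_cast hM)]
    linarith
  obtain ⟨C, hC⟩ : ∃ C, C = 3 * Real.log (2 * 2 ^ (N - 1)) + Real.log 4 := ⟨_, rfl⟩
  -- The bound `16` locates the roots, `log t > 2C` makes the unit logarithms independent, and the
  -- last bound produces vectors shorter than `ρ`.
  refine ⟨max 16 ⌈Real.exp (max (2 * C) (4 * M * (5 * C - Real.log ρ)))⌉, fun t ht => ?_⟩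
  have ht1 : (16 : ℤ) < t := (le_max_left _ _).trans_lt ht
  have ht2 : Real.exp (max (2 * C) (4 * M * (5 * C - Real.log ρ))) < t := by
    refine (Int.le_ceil _).trans_lt ?_
    exact_mod_cast (le_max_right _ _).trans_lt ht
  have htR : (16 : ℝ) ≤ t := by exact_mod_cast ht1.le
  rw [← Real.lt_log_iff_exp_lt (by linarith), max_lt_iff] at ht2
  have hirr := EscapeOfMass.familyPoly_irreducible (t := t) (by lia) hN
  have hfm := EscapeOfMass.familyPoly_monic t N
  obtain ⟨F, _, _, θ, hrank, hli, hθ⟩ := EscapeOfMass.exists_cubicField hirr (hfm.map _)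
    (by rw [hfm.natDegree_map, EscapeOfMass.familyPoly_natDegree])
  rw [← algebraMap_int_eq, Polynomial.aeval_map_algebraMap] at hθ
  obtain ⟨r, hr⟩ := EscapeOfMass.exists_isRootTriple (b := 2 ^ (N - 1))
    (one_le_pow₀ (by norm_num)) htR
  refine ⟨F, inferInstance, inferInstance, θ, hrank, ?_, hθ,
    fun k => ?_, EscapeOfMass.strictAnti_adjoin hli hθ, fun σ k => ?_⟩
  · refine EscapeOfMass.isTotallyReal_of_isRootTriple hrank hli hr fun φ => ?_
    exact_mod_cast EscapeOfMass.root_equation hN hθ φ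
  · exact EscapeOfMass.isOrder_adjoin hrank (EscapeOfMass.linearIndependent_smul_pow hli k)
      (EscapeOfMass.aeval_two_pow_mul k.2 hθ)
  · exact EscapeOfMass.orbit_of_adjoin hN hrank hli hθ htR hC ht2.1 hK hρ hKρ hM ht2.2 hMε' σ k
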